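/- Let $\mathcal H$ be a complex Hilbert space (inner product antilinear in the first argument), and let $\mathcal A=\mathrm{CAR}(\mathcal H)$ be the universal unital C*-algebra generated by elements $a(f)$, $f\in\mathcal H$, with $f\mapsto a(f)$ antilinear and $$a(f)a(g)+a(g)a(f)=0,\qquad a(f)a(g)^*+a(g)^*a(f)=\langle f,g\rangle\mathbf 1 .$$ Let $\rho=(\rho_t)_{t\in\mathbb R}$ be the strongly continuous one-parameter group of *-automorphisms of $\mathcal A$ with $\rho_t(a(f))=e^{-\mathrm i t}a(f)$, and let $\delta^\rho(x)=\lim_{t\to0^+}\frac1t(\rho_t(x)-x)$ be its generator, with domain $\mathcal D(\delta^\rho)$ the set of $x\in\mathcal A$ for which this norm limit exists. A pair $(\omega_1,\omega_2)$ of pure states of $\mathcal A$ is called $\rho$-locally-comparable if there is a unitary $u\in\mathcal A\cap\mathcal D(\delta^\rho)$ with $\omega_2(x)=\omega_1(u^*xu)$ for all $x\in\mathcal A$. If moreover $\omega_1,\omega_2$ are $\rho$-invariant, put $\mathcal N_\rho(\omega_1,\omega_2)=\mathrm i\,\omega_1(u^*\delta^\rho(u))$ for any such $u$. For an orthogonal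 projection $P$ on $\mathcal H$, the quasi-free state $\omega_P$ is the unique continuous linear functional on $\mathcal A$ with $$\omega_P\bigl(a(f_1)^*\cdots a(f_m)^*a(g_n)\cdots a(g_1)\bigr)=\delta_{n,m}\det\bigl(\langle g_i,Pf_j\rangle\bigr)_{i,j=1}^n$$ for all $m,n\ge 0$ and $f_i,g_j\in\mathcal H$. **Theorem.** Let $P_1,P_2$ be orthogonal projections on $\mathcal H$ such that $P_1-P_2$ is trace class. Then the quasi-free functionals $\omega_{P_1},\omega_{P_2}$ exist and are unique, they are $\rho$-invariant pure states, and $(\omega_{P_1},\omega_{P_2})$ is $\rho$-locally-comparable. The operator $P_2P_1|_{\operatorname{im}P_1}:\operatorname{im}P_1\to\operatorname{im}P_2$ is Fredholm, the number $\mathrm i\,\omega_{P_1}(u^*\delta^\rho(u))$ does not depend on the choice of the unitary $u$ above, and $$\mathcal N_\rho(\omega_{P_1},\omega_{P_2})=\operatorname{index}(P_1,P_2):=\dim\ker\bigl(P_2P_1|_{\operatorname{im}P_1}\bigr)-\dim\operatorname{coker}\bigl(P_2P_1|_{\operatorname{im}P_1}\bigr).$$ -/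

import Mathlib

open Filter Topology
open scoped ENNReal ComplexOrder InnerProductSpace

universe u

noncomputable section

/-! ### States, flows and the index of a pair of states on a unital C*-algebra -/

section Abstract

variable {A : Type*} [CStarAlgebra A]

/-- The states of `A`: positive linear functionals `ω` with `ω 1 = 1`. (Positive functionals on a
C*-algebra are automatically continuous, so nothing is lost by working inside the dual space.) -/
def stateSpace (A : Type*) [CStarAlgebra A] : Set (A →L[ℂ] ℂ) :=
  {ω | (∀ a : A, 0 ≤ ω (star a * a)) ∧ ω 1 = 1}

/-- The pure states of `A`: the extreme points of the state space. -/
def pureStates (A : Type*) [CStarAlgebra A] : Set (A →L[ℂ] ℂ) :=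
  Set.extremePoints ℝ (stateSpace A)

/-- A strongly continuous one-parameter group of *-automorphisms of `A`. -/
structure AutFlow (A : Type*) [CStarAlgebra A] where
  /-- the automorphism at time `t` -/
  aut : ℝ → A ≃⋆ₐ[ℂ] A
  aut_zero : ∀ a, aut 0 a = a
  aut_add : ∀ s t a, aut (s + t) a = aut s (aut t a)
  continuous_aut : ∀ a, Continuous fun t => aut t a

/-- `ρ.HasGenerator a b` says that `a` is in the domain of the generator `δ` of `ρ`, and that
`δ a = b`, i.e. `(ρ_t(a) - a) / t → b` in norm as `t → 0+`. -/
def AutFlow.HasGenerator (ρ : AutFlow A) (a b : A) : Prop :=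
  Tendsto (fun t : ℝ => t⁻¹ • (ρ.aut t a - a)) (𝓝[>] 0) (𝓝 b)

/-- The domain of the generator `δ` of `ρ`. -/
def AutFlow.domain (ρ : AutFlow A) : Set A :=
  {a | ∃ b, ρ.HasGenerator a b}

open Classical in
/-- The generator `δ` of `ρ`, extended by zero outside its domain. -/
def AutFlow.generator (ρ : AutFlow A) (a : A) : A :=
  if h : a ∈ ρ.domain then h.choose else 0

/-- The state (or functional) `ω` is invariant under `ρ`. -/
def AutFlow.Invariant (ρ : AutFlow A) (ω : A →L[ℂ] ℂ) : Prop :=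
  ∀ t a, ω (ρ.aut t a) = ω a

/-- The unitaries `u` in the domain of `δ` with `ω₂ = ω₁ ∘ Ad u`, where `Ad u a = u* a u`. -/
def AutFlow.intertwiners (ρ : AutFlow A) (ω₁ ω₂ : A →L[ℂ] ℂ) : Set A :=
  {u | u ∈ unitary A ∧ u ∈ ρ.domain ∧ ∀ a, ω₂ a = ω₁ (star u * a * u)}

/-- `(ω₁, ω₂)` is a `ρ`-locally-comparable pair of pure states. -/
def AutFlow.LocallyComparable (ρ : AutFlow A) (ω₁ ω₂ : A →L[ℂ] ℂ) : Prop :=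
  ω₁ ∈ pureStates A ∧ ω₂ ∈ pureStates A ∧ (ρ.intertwiners ω₁ ω₂).Nonempty

open Classical in
/-- The index `N_ρ(ω₁, ω₂) = i ω₁(u* δ(u))`, for some choice of a unitary `u` in the domain of `δ`
with `ω₂ = ω₁ ∘ Ad u` (and `0` if there is none). -/
def AutFlow.index (ρ : AutFlow A) (ω₁ ω₂ : A →L[ℂ] ℂ) : ℂ :=
  if h : (ρ.intertwiners ω₁ ω₂).Nonempty then
    Complex.I * ω₁ (star h.some * ρ.generator h.some)
  else 0

end Abstract

/-! ### The CAR algebra -/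

section CAR

/-- Annihilation operators over `H` in some nonzero unital C*-algebra: an antilinear map
`f ↦ a f` satisfying the canonical anticommutation relations. -/
structure CARSystem (H : Type u) [NormedAddCommGroup H] [InnerProductSpace ℂ H] :
    Type (u + 1) where
  /-- the C*-algebra -/
  Alg : Type u
  [cstar : CStarAlgebra Alg]
  [nontriv : Nontrivial Alg]
  /-- the annihilation operators -/
  a : H →ₗ⋆[ℂ] Alg
  anticomm : ∀ f g, a f * a g + a g * a f = 0
  anticomm_star : ∀ f g, a f * star (a g) + star (a g) * a f = ⟪f, g⟫_ℂ • (1 : Alg)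

attribute [instance] CARSystem.cstar CARSystem.nontriv

variable {H : Type u} [NormedAddCommGroup H] [InnerProductSpace ℂ H]

theorem StarAlgHom.continuous_of_cstar {A B : Type*} [CStarAlgebra A] [CStarAlgebra B]
    (φ : A →⋆ₐ[ℂ] B) : Continuous φ :=
  AddMonoidHomClass.continuous_of_bound φ 1 fun x => by
    simpa using NonUnitalStarAlgHom.norm_apply_le φ x

theorem CARSystem.norm_a_le (c : CARSystem H) (f : H) : ‖c.a f‖ ≤ ‖f‖ := by
  have hsq : c.a f * c.a f = 0 := by
    have h := c.anticomm f f
    rw [← two_smul ℂ] at h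
    exact (smul_eq_zero.mp h).resolve_left two_ne_zero
  have hx : star (star (c.a f) * c.a f) * (star (c.a f) * c.a f)
      = ⟪f, f⟫_ℂ • (star (c.a f) * c.a f) := by
    have h := c.anticomm_star f f
    calc star (star (c.a f) * c.a f) * (star (c.a f) * c.a f)
        = star (c.a f) * (c.a f * star (c.a f) + star (c.a f) * c.a f) * c.a f
            - star (c.a f) * star (c.a f) * (c.a f * c.a f) := by
          simp only [star_mul, star_star]; noncomm_ring
      _ = ⟪f, f⟫_ℂ • (star (c.a f) * c.a f) := by
          rw [h, hsq]; simp
  have hn := congrArg norm hx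
  rw [CStarRing.norm_star_mul_self, norm_smul, CStarRing.norm_star_mul_self,
    inner_self_eq_norm_sq_to_K] at hn
  simp only [Complex.coe_algebraMap, norm_pow, Complex.norm_real, norm_norm] at hn
  by_contra! hlt
  have h0 : 0 ≤ ‖f‖ := norm_nonneg f
  have h1 : 0 < ‖c.a f‖ := h0.trans_lt hlt
  have h2 : ‖c.a f‖ * ‖c.a f‖ = ‖f‖ ^ 2 := mul_right_cancel₀ (mul_pos h1 h1).ne' hn
  nlinarith

variable (H) in
/-- The C*-algebra of bounded families indexed by all CAR systems over `H`. -/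
abbrev CARProduct : Type (u + 1) := lp (fun c : CARSystem H => c.Alg) ∞

instance : CStarAlgebra (CARProduct H) where

/-- The family whose component in each CAR system is the annihilation operator of `f`. -/
def CARProduct.a (f : H) : CARProduct H :=
  ⟨fun c => c.a f, memℓp_infty ⟨‖f‖, by rintro _ ⟨c, rfl⟩; exact c.norm_a_le f⟩⟩

variable (H) in
/-- The closed unital *-subalgebra generated by the annihilation operators. -/
def carSubalgebra : StarSubalgebra ℂ (CARProduct H) :=
  (StarAlgebra.adjoin ℂ (Set.range (CARProduct.a (H := H)))).topologicalClosure

instance : IsClosed (carSubalgebra H : Set (CARProduct H)) :=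
  StarSubalgebra.isClosed_topologicalClosure _

variable (H) in
/-- The CAR algebra over `H`: the universal unital C*-algebra generated by elements `a f`
satisfying the canonical anticommutation relations. It is realized as the C*-algebra generated by
the family of the annihilation operators of all CAR systems, so that the norm of a polynomial in the
`a f` and their adjoints is the supremum of its norms in all CAR systems. -/
def CAR : Type (u + 1) := carSubalgebra H

instance : CStarAlgebra (CAR H) := inferInstanceAs (CStarAlgebra (carSubalgebra H))

namespace CAR

/-- The annihilation operator `a f` in the CAR algebra. -/
def a (f : H) : CAR H :=
  (⟨CARProduct.a f, StarSubalgebra.le_topologicalClosure _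
    (StarAlgebra.subset_adjoin ℂ _ ⟨f, rfl⟩)⟩ : carSubalgebra H)

/-- The component of an element of the CAR algebra in the CAR system `c`: the canonical
*-homomorphism to `c.Alg` that sends `a f` to `c.a f`. -/
def eval (c : CARSystem H) : CAR H →⋆ₐ[ℂ] c.Alg where
  toFun x := (x.1 : CARProduct H) c
  map_one' := rfl
  map_mul' _ _ := rfl
  map_zero' := rfl
  map_add' _ _ := rfl
  commutes' _ := rfl
  map_star' _ := rfl

theorem eval_a (c : CARSystem H) (f : H) : eval c (a f) = c.a f := rfl

theorem ext_eval {x y : CAR H} (h : ∀ c, eval c x = eval c y) : x = y :=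
  Subtype.ext (lp.ext (funext h))

theorem anticomm (f g : H) : a f * a g + a g * a f = 0 :=
  ext_eval fun c => by simpa [eval_a] using c.anticomm f g

theorem anticomm_star (f g : H) :
    a f * star (a g) + star (a g) * a f = ⟪f, g⟫_ℂ • (1 : CAR H) :=
  ext_eval fun c => by simpa [eval_a, map_star] using c.anticomm_star f g

/-- A *-homomorphism on the CAR algebra is determined by its values on the `a f`. -/
theorem hom_ext {B : Type*} [CStarAlgebra B] {φ ψ : CAR H →⋆ₐ[ℂ] B}
    (h : ∀ f, φ (a f) = ψ (a f)) : φ = ψ := by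
  refine StarAlgHom.ext_topologicalClosure (S := StarAlgebra.adjoin ℂ
    (Set.range (CARProduct.a (H := H)))) (φ := φ) (ψ := ψ) ?_ ?_ ?_
  · exact StarAlgHom.continuous_of_cstar φ
  · exact StarAlgHom.continuous_of_cstar ψ
  · refine StarAlgHom.ext_adjoin fun x hx => ?_
    obtain ⟨f, hf⟩ := hx
    have : x = ⟨CARProduct.a f, StarAlgebra.subset_adjoin ℂ _ ⟨f, rfl⟩⟩ := Subtype.ext hf.symm
    subst this
    exact h f

end CAR

/-- The CAR system `f ↦ z a(f)` for a phase `z`. -/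
@[reducible] def CARSystem.rotate (z : Circle) (c : CARSystem H) : CARSystem H where
  Alg := c.Alg
  a := (z : ℂ) • c.a
  anticomm f g := by
    have h := c.anticomm f g
    simp only [LinearMap.smul_apply, smul_mul_smul_comm, ← smul_add, h, smul_zero]
  anticomm_star f g := by
    have h := c.anticomm_star f g
    have hz : (z : ℂ) * star (z : ℂ) = 1 := by
      simp [Complex.mul_conj, Circle.normSq_coe]
    simp only [LinearMap.smul_apply, star_smul, smul_mul_smul_comm, mul_comm (star (z : ℂ)), hz,
      one_smul, h]

/-- Reindexing of families along `c ↦ c.rotate z`. -/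
def CARProduct.rotate (z : Circle) : CARProduct H →⋆ₐ[ℂ] CARProduct H where
  toFun x := ⟨fun c => x (c.rotate z), memℓp_infty ⟨‖x‖, by
    rintro _ ⟨c, rfl⟩
    exact lp.norm_apply_le_norm ENNReal.top_ne_zero x (c.rotate z)⟩⟩
  map_one' := rfl
  map_mul' _ _ := rfl
  map_zero' := rfl
  map_add' _ _ := rfl
  commutes' _ := rfl
  map_star' _ := rfl

namespace CAR

theorem rotate_mem (z : Circle) (x : CARProduct H) (hx : x ∈ carSubalgebra H) :
    CARProduct.rotate z x ∈ carSubalgebra H := by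
  have hcl : IsClosed ((carSubalgebra H).comap (CARProduct.rotate z) : Set (CARProduct H)) :=
    IsClosed.preimage (t := (carSubalgebra H : Set (CARProduct H)))
      (CARProduct.rotate (H := H) z).continuous_of_cstar inferInstance
  refine StarSubalgebra.topologicalClosure_minimal (StarAlgebra.adjoin_le ?_) hcl hx
  rintro _ ⟨f, rfl⟩
  have : CARProduct.rotate z (CARProduct.a f) = (z : ℂ) • CARProduct.a f := rfl
  show CARProduct.rotate z (CARProduct.a f) ∈ carSubalgebra H
  rw [this]
  exact SMulMemClass.smul_mem _ (CAR.a f).2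

/-- The *-endomorphism of the CAR algebra with `a f ↦ z a f`, for a phase `z`. -/
def rotate (z : Circle) : CAR H →⋆ₐ[ℂ] CAR H where
  toFun x := (⟨CARProduct.rotate z x.1, rotate_mem z _ x.2⟩ : carSubalgebra H)
  map_one' := rfl
  map_mul' _ _ := rfl
  map_zero' := rfl
  map_add' _ _ := rfl
  commutes' _ := rfl
  map_star' _ := rfl

theorem rotate_a (z : Circle) (f : H) : rotate z (a f) = (z : ℂ) • a f := rfl

theorem rotate_one (x : CAR H) : rotate 1 x = x := by
  have : rotate (H := H) 1 = StarAlgHom.id ℂ (CAR H) := hom_ext fun f => by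
    simp [rotate_a]
  rw [this]; rfl

theorem rotate_mul (z w : Circle) (x : CAR H) : rotate (z * w) x = rotate z (rotate w x) := by
  have : rotate (H := H) (z * w) = (rotate z).comp (rotate w) := hom_ext fun f => by
    simp [rotate_a, smul_smul, mul_comm]
  rw [this]; rfl

theorem continuous_rotate (x : CAR H) : Continuous fun z : Circle => rotate z x := by
  suffices h : ∀ y ∈ carSubalgebra H, Continuous fun z : Circle => CARProduct.rotate z y from
    (h x.1 x.2).subtype_mk fun z => rotate_mem z _ x.2
  intro y hy
  refine continuous_of_uniform_approx_of_continuous fun U hU => ?_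
  obtain ⟨ε, hε, hU⟩ := Metric.mem_uniformity_dist.mp hU
  obtain ⟨w, hw, hyw⟩ := Metric.mem_closure_iff.mp hy ε hε
  refine ⟨fun z => CARProduct.rotate z w, ?_, fun z => hU ?_⟩
  · refine StarAlgebra.adjoin_induction (p := fun v _ => Continuous fun z : Circle =>
      CARProduct.rotate z v) ?_ ?_ ?_ ?_ ?_ hw
    · rintro _ ⟨f, rfl⟩
      exact ((continuous_subtype_val.smul continuous_const) :
        Continuous fun z : Circle => (z : ℂ) • CARProduct.a f)
    · intro r
      simp only [AlgHomClass.commutes]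
      exact continuous_const
    · intro v v' _ _ hv hv'
      simp only [map_add]
      exact hv.add hv'
    · intro v v' _ _ hv hv'
      simp only [map_mul]
      exact hv.mul hv'
    · intro v _ hv
      simpa only [map_star] using hv.star
  · rw [dist_eq_norm, ← map_sub]
    refine (NonUnitalStarAlgHom.norm_apply_le _ _).trans_lt ?_
    rwa [← dist_eq_norm]

variable (H) in
/-- The charge `U(1)` action on the CAR algebra: `ρ_t(a f) = e^{-it} a f`. -/
def charge : AutFlow (CAR H) where
  aut t :=
    { rotate (H := H) (Circle.exp (-t)) with
      invFun := rotate (Circle.exp t)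
      left_inv := fun x => by
        show rotate _ (rotate _ x) = x
        rw [← rotate_mul, ← Circle.exp_add]; simp [rotate_one]
      right_inv := fun x => by
        show rotate _ (rotate _ x) = x
        rw [← rotate_mul, ← Circle.exp_add]; simp [rotate_one]
      map_smul' := fun r x => map_smul (rotate (H := H) (Circle.exp (-t))) r x }
  aut_zero x := by
    show rotate _ x = x
    simp [rotate_one]
  aut_add s t x := by
    show rotate _ x = rotate _ (rotate _ x)
    rw [← rotate_mul, ← Circle.exp_add, neg_add]
  continuous_aut x := (continuous_rotate x).comp (Circle.exp.continuous.comp continuous_neg)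

theorem charge_a (t : ℝ) (f : H) :
    (charge H).aut t (a f) = Complex.exp (-(Complex.I * t)) • a f := by
  show rotate _ (a f) = _
  rw [rotate_a, Circle.coe_exp]
  congr 2
  push_cast
  ring

theorem charge_star_a (t : ℝ) (f : H) :
    (charge H).aut t (star (a f)) = Complex.exp (Complex.I * t) • star (a f) := by
  rw [map_star, charge_a, star_smul]
  congr 1
  simp [← Complex.exp_conj]

end CAR

end CAR

/-! ### Quasi-free states -/

section QuasiFree

variable {H : Type u} [NormedAddCommGroup H] [InnerProductSpace ℂ H]

/-- `ω` is the quasi-free functional associated to `P`: it is linear and continuous, and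
`ω(a(f₁)* ⋯ a(fₘ)* a(gₙ) ⋯ a(g₁)) = δ_{nm} det (⟨gᵢ, P fⱼ⟩)`. -/
structure IsQuasiFree (P : H →L[ℂ] H) (ω : CAR H →L[ℂ] ℂ) : Prop where
  eq_det : ∀ (n : ℕ) (f g : Fin n → H),
    ω ((List.ofFn fun i => star (CAR.a (f i))).prod *
        (List.ofFn fun i => CAR.a (g i)).reverse.prod) =
      (Matrix.of fun i j => ⟪g i, P (f j)⟫_ℂ).det
  eq_zero : ∀ (m n : ℕ) (f : Fin m → H) (g : Fin n → H), m ≠ n →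
    ω ((List.ofFn fun i => star (CAR.a (f i))).prod *
        (List.ofFn fun i => CAR.a (g i)).reverse.prod) = 0

end QuasiFree

/-! ### Trace class operators and the index of a pair of projections -/

section Projections

variable {H : Type u} [NormedAddCommGroup H] [InnerProductSpace ℂ H]

/-- `T` is trace class: `∑ᵢ ⟨eᵢ, |T| eᵢ⟩ < ∞` for an orthonormal basis `(eᵢ)` of `H`, where
`|T| = (T* T)^{1/2}`. (The sum does not depend on the basis.) -/
def IsTraceClass [CompleteSpace H] (T : H →L[ℂ] H) : Prop :=
  ∃ (ι : Type u) (e : HilbertBasis ι ℂ H), Summable fun i => ‖⟪e i, CFC.abs T (e i)⟫_ℂ‖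

/-- The operator `P₂ P₁` restricted to a map from the range of `P₁` to the range of `P₂`. -/
def pairOperator (P₁ P₂ : H →L[ℂ] H) : P₁.range →L[ℂ] P₂.range :=
  ((P₂ ∘L P₁) ∘L P₁.range.subtypeL).codRestrict P₂.range fun x => ⟨P₁ x, rfl⟩

/-- The index `dim ker T - dim coker T` of a Fredholm operator `T`. -/
def fredholmIndex {E F : Type*} [NormedAddCommGroup E] [NormedSpace ℂ E] [NormedAddCommGroup F]
    [NormedSpace ℂ F] (T : E →L[ℂ] F) : ℤ :=
  (Module.finrank ℂ T.ker : ℤ) - Module.finrank ℂ (F ⧸ T.range)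

end Projections

end

noncomputable section

/-! ### States -/

section States

variable {A : Type*} [CStarAlgebra A]

theorem eq_zero_of_forall_nat_mul_add_nonneg {s c : ℂ} (h : ∀ n : ℤ, 0 ≤ (n : ℂ) * s + c) :
    s = 0 := by
  have him : s.im = 0 := by
    have h0 := (Complex.le_def.mp (h 0)).2
    have h1 := (Complex.le_def.mp (h 1)).2
    simp at h0 h1
    linarith
  have hre : ∀ n : ℤ, 0 ≤ (n : ℝ) * s.re + c.re := fun n => by
    simpa using (Complex.le_def.mp (h n)).1
  refine Complex.ext ?_ him
  by_contra hs
  simp only [Complex.zero_re] at hs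
  obtain ⟨n, hn⟩ := exists_int_gt (c.re / |s.re|)
  have hpos : 0 < |s.re| := abs_pos.mpr hs
  rw [div_lt_iff₀ hpos] at hn
  rcases abs_cases s.re with ⟨h1, _⟩ | ⟨h1, _⟩
  · have := hre (-n)
    push_cast at this
    rw [h1] at hn
    linarith
  · have := hre n
    rw [h1] at hn
    linarith

/-- The Cauchy-Schwarz inequality in the degenerate case. -/
theorem stateSpace_apply_eq_zero {ω : A →L[ℂ] ℂ} (hω : ω ∈ stateSpace A) {x : A}
    (hx : ω (star x * x) = 0) (y : A) : ω (y * x) = 0 ∧ ω (star x * y) = 0 := by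
  suffices h : ∀ y, ω (star y * x) = 0 ∧ ω (star x * y) = 0 by
    refine ⟨?_, (h y).2⟩
    simpa using (h (star y)).1
  intro y
  have key : ∀ z : ℂ, 0 ≤ z * ω (star y * x) + star z * ω (star x * y) + ω (star y * y) := by
    intro z
    have h := hω.1 (y + z • x)
    have e : star (y + z • x) * (y + z • x) = star y * y + z • (star y * x)
        + star z • (star x * y) + (star z * z) • (star x * x) := by
      simp only [star_add, star_smul, add_mul, mul_add, smul_mul_assoc, mul_smul_comm]
      module
    rw [e] at h
    simp only [map_add, map_smul, hx, smul_eq_mul, mul_zero, add_zero] at h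
    convert h using 1
    ring
  have h1 : ω (star y * x) + ω (star x * y) = 0 :=
    eq_zero_of_forall_nat_mul_add_nonneg (c := ω (star y * y)) fun n => by
      have := key n
      simp only [star_intCast] at this
      rwa [mul_add]
  have h2 : Complex.I * (ω (star y * x) - ω (star x * y)) = 0 :=
    eq_zero_of_forall_nat_mul_add_nonneg (c := ω (star y * y)) fun n => by
      have := key (n * Complex.I)
      simp only [star_mul', star_intCast, Complex.star_def, Complex.conj_I] at this
      convert this using 1
      ring
  have h3 := (mul_eq_zero.mp h2).resolve_left Complex.I_ne_zero
  exact ⟨by linear_combination (h1 + h3) / 2, by linear_combination (h1 - h3) / 2⟩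

end States

/-! ### Normally ordered monomials and vacuum functionals -/

namespace CAR

variable {H : Type u} [NormedAddCommGroup H] [InnerProductSpace ℂ H]

theorem a_smul (z : ℂ) (f : H) : a (z • f) = star z • a f :=
  ext_eval fun c => by simp [eval_a]

theorem a_sub (f g : H) : a (f - g) = a f - a g :=
  ext_eval fun c => by simp [eval_a]

theorem a_mul_a (f g : H) : a f * a g = -(a g * a f) :=
  eq_neg_of_add_eq_zero_left (anticomm f g)

theorem a_mul_star_a (f g : H) : a f * star (a g) = ⟪f, g⟫_ℂ • 1 - star (a g) * a f :=
  eq_sub_of_add_eq (anticomm_star f g)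

theorem star_a_mul_star_a (f g : H) : star (a f) * star (a g) = -(star (a g) * star (a f)) := by
  simpa using congrArg star (a_mul_a g f)

/-- An induction principle for the CAR algebra. -/
theorem closure_induction {p : CAR H → Prop} (hcl : IsClosed {x | p x}) (ha : ∀ f, p (a f))
    (hr : ∀ r : ℂ, p (algebraMap ℂ _ r)) (hadd : ∀ x y, p x → p y → p (x + y))
    (hmul : ∀ x y, p x → p y → p (x * y)) (hstar : ∀ x, p x → p (star x)) (x : CAR H) : p x := by
  have hmem : ∀ y (hy : y ∈ StarAlgebra.adjoin ℂ (Set.range (CARProduct.a (H := H)))),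
      p (⟨y, StarSubalgebra.le_topologicalClosure _ hy⟩ : carSubalgebra H) := by
    intro y hy
    refine StarAlgebra.adjoin_induction
      (p := fun y hy => p (⟨y, StarSubalgebra.le_topologicalClosure _ hy⟩ : carSubalgebra H))
      ?_ ?_ ?_ ?_ ?_ hy
    · rintro _ ⟨f, rfl⟩
      exact ha f
    · exact fun r => hr r
    · exact fun x y _ _ hx hy => hadd _ _ hx hy
    · exact fun x y _ _ hx hy => hmul _ _ hx hy
    · exact fun x _ hx => hstar _ hx
  have hx : x ∈ closure {x | p x} := by
    refine Metric.mem_closure_iff.mpr fun ε hε => ?_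
    obtain ⟨w, hw, hxw⟩ := Metric.mem_closure_iff.mp x.2 ε hε
    exact ⟨_, hmem w hw, hxw⟩
  exact hcl.closure_subset hx

/-- The product `a(f₁)* ⋯ a(fₘ)*`. -/
def creators {m : ℕ} (f : Fin m → H) : CAR H := (List.ofFn fun i => star (a (f i))).prod

/-- The product `a(gₙ) ⋯ a(g₁)`. -/
def annihilators {n : ℕ} (g : Fin n → H) : CAR H := (List.ofFn fun i => a (g i)).reverse.prod

theorem creators_zero (f : Fin 0 → H) : creators f = 1 := by simp [creators]

theorem annihilators_zero (g : Fin 0 → H) : annihilators g = 1 := by simp [annihilators]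

theorem creators_succ {m : ℕ} (f : Fin (m + 1) → H) :
    creators f = star (a (f 0)) * creators (fun i => f i.succ) := by
  simp [creators, List.ofFn_succ]

theorem annihilators_succ {n : ℕ} (g : Fin (n + 1) → H) :
    annihilators g = annihilators (fun i => g i.succ) * a (g 0) := by
  simp [annihilators, List.ofFn_succ]

theorem annihilators_snoc {n : ℕ} (g : Fin n → H) (h : H) :
    annihilators (Fin.snoc g h : Fin (n + 1) → H) = a h * annihilators g := by
  rw [annihilators, List.ofFn_succ_last]
  simp [annihilators]

theorem annihilators_mul_a {n : ℕ} (g : Fin n → H) (h : H) :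
    annihilators g * a h = (-1 : ℂ) ^ n • (a h * annihilators g) := by
  induction n with
  | zero => simp [annihilators_zero]
  | succ n ih =>
    rw [annihilators_succ, mul_assoc, a_mul_a, mul_neg, ← mul_assoc, ih, smul_mul_assoc, pow_succ,
      mul_assoc]
    simp

theorem star_a_mul_creators {m : ℕ} (f : Fin m → H) (h : H) :
    star (a h) * creators f = (-1 : ℂ) ^ m • (creators f * star (a h)) := by
  induction m with
  | zero => simp [creators_zero]
  | succ m ih =>
    rw [creators_succ, ← mul_assoc, star_a_mul_star_a, neg_mul, mul_assoc, ih, mul_smul_comm,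
      pow_succ, ← mul_assoc]
    simp

theorem a_mul_creators {k : ℕ} (f : Fin (k + 1) → H) (g : H) :
    a g * creators f = ∑ j : Fin (k + 1), ((-1 : ℂ) ^ (j : ℕ) * ⟪g, f j⟫_ℂ) •
        creators (fun i => f (j.succAbove i)) + (-1 : ℂ) ^ (k + 1) • (creators f * a g) := by
  induction k with
  | zero =>
    simp [creators_succ, creators_zero, a_mul_star_a, sub_eq_add_neg]
  | succ k ih =>
    have h := ih fun i => f i.succ
    rw [Fin.sum_univ_succ, creators_succ, ← mul_assoc, a_mul_star_a, sub_mul, mul_assoc, h]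
    simp only [Fin.succAbove_zero, Fin.val_zero, pow_zero, one_mul, smul_mul_assoc, mul_add,
      mul_smul_comm, Finset.mul_sum, Fin.val_succ]
    have : ∀ j : Fin (k + 1), creators (fun i => f (j.succ.succAbove i)) =
        star (a (f 0)) * creators (fun i => f (j.succAbove i).succ) := fun j => by
      rw [creators_succ]
      simp
    simp only [this, pow_succ, mul_assoc]
    simp only [mul_neg, neg_mul, neg_smul, mul_one, one_mul, Finset.sum_neg_distrib]
    abel

variable (H) in
/-- The linear span of the normally ordered monomials. -/
def normalOrdered : Submodule ℂ (CAR H) :=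
  Submodule.span ℂ {x | ∃ (m n : ℕ) (f : Fin m → H) (g : Fin n → H),
    x = creators f * annihilators g}

theorem creators_mul_annihilators_mem {m n : ℕ} (f : Fin m → H) (g : Fin n → H) :
    creators f * annihilators g ∈ normalOrdered H :=
  Submodule.subset_span ⟨m, n, f, g, rfl⟩

theorem a_mul_mem_normalOrdered (h : H) {x : CAR H} (hx : x ∈ normalOrdered H) :
    a h * x ∈ normalOrdered H := by
  induction hx using Submodule.span_induction with
  | mem x hx =>
    obtain ⟨m, n, f, g, rfl⟩ := hx
    cases m with
    | zero =>
      rw [creators_zero, one_mul, ← annihilators_snoc, ← one_mul (annihilators _),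
        ← creators_zero f]
      exact creators_mul_annihilators_mem _ _
    | succ m =>
      rw [← mul_assoc, a_mul_creators, add_mul, Finset.sum_mul, smul_mul_assoc, mul_assoc,
        ← annihilators_snoc]
      refine add_mem (sum_mem fun j _ => ?_) (Submodule.smul_mem _ _ ?_)
      · rw [smul_mul_assoc]
        exact Submodule.smul_mem _ _ (creators_mul_annihilators_mem _ _)
      · exact creators_mul_annihilators_mem _ _
  | zero => simp
  | add x y _ _ hx hy => rw [mul_add]; exact add_mem hx hy
  | smul r x _ hx => rw [mul_smul_comm]; exact Submodule.smul_mem _ _ hx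

theorem star_a_mul_mem_normalOrdered (h : H) {x : CAR H} (hx : x ∈ normalOrdered H) :
    star (a h) * x ∈ normalOrdered H := by
  induction hx using Submodule.span_induction with
  | mem x hx =>
    obtain ⟨m, n, f, g, rfl⟩ := hx
    have : star (a h) * (creators f * annihilators g) =
        creators (Fin.cons h f : Fin (m + 1) → H) * annihilators g := by
      rw [creators_succ, ← mul_assoc]
      simp
    rw [this]
    exact creators_mul_annihilators_mem _ _
  | zero => simp
  | add x y _ _ hx hy => rw [mul_add]; exact add_mem hx hy
  | smul r x _ hx => rw [mul_smul_comm]; exact Submodule.smul_mem _ _ hx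

theorem mul_mem_closure_normalOrdered {c : CAR H}
    (hc : ∀ x ∈ normalOrdered H, c * x ∈ normalOrdered H) {x : CAR H}
    (hx : x ∈ (normalOrdered H).topologicalClosure) :
    c * x ∈ (normalOrdered H).topologicalClosure :=
  map_mem_closure (continuous_const_mul c) hx hc

/-- The normally ordered monomials span a dense subspace. -/
theorem dense_normalOrdered : Dense (normalOrdered H : Set (CAR H)) := by
  have key : ∀ x : CAR H, ∀ y ∈ (normalOrdered H).topologicalClosure,
      x * y ∈ (normalOrdered H).topologicalClosure ∧
        star x * y ∈ (normalOrdered H).topologicalClosure := by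
    refine closure_induction ?_ ?_ ?_ ?_ ?_ ?_
    · simp only [Set.ofPred_forall]
      refine isClosed_biInter fun y _ => ?_
      have hc : IsClosed ((normalOrdered H).topologicalClosure : Set (CAR H)) :=
        Submodule.isClosed_topologicalClosure _
      exact (hc.preimage (continuous_mul_const y)).inter
        (hc.preimage ((continuous_mul_const y).comp continuous_star))
    · exact fun f y hy => ⟨mul_mem_closure_normalOrdered (fun _ => a_mul_mem_normalOrdered f) hy,
        mul_mem_closure_normalOrdered (fun _ => star_a_mul_mem_normalOrdered f) hy⟩
    · intro r y hy
      rw [Algebra.algebraMap_eq_smul_one, star_smul, star_one, smul_one_mul, smul_one_mul]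
      exact ⟨Submodule.smul_mem _ _ hy, Submodule.smul_mem _ _ hy⟩
    · intro x x' hx hx' y hy
      rw [star_add, add_mul, add_mul]
      exact ⟨add_mem (hx y hy).1 (hx' y hy).1, add_mem (hx y hy).2 (hx' y hy).2⟩
    · intro x x' hx hx' y hy
      rw [star_mul, mul_assoc, mul_assoc]
      exact ⟨(hx _ (hx' y hy).1).1, (hx' _ (hx y hy).2).2⟩
    · intro x hx y hy
      rw [star_star]
      exact (hx y hy).symm
  have h1 : (1 : CAR H) ∈ (normalOrdered H).topologicalClosure := by
    refine Submodule.le_topologicalClosure _ ?_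
    have := creators_mul_annihilators_mem (H := H) (fun i : Fin 0 => i.elim0)
      (fun i : Fin 0 => i.elim0)
    rwa [creators_zero, annihilators_zero, one_mul] at this
  intro x
  have := (key x 1 h1).1
  rwa [mul_one] at this

theorem functional_ext {φ ψ : CAR H →L[ℂ] ℂ}
    (h : ∀ (m n : ℕ) (f : Fin m → H) (g : Fin n → H),
      φ (creators f * annihilators g) = ψ (creators f * annihilators g)) : φ = ψ := by
  refine ContinuousLinearMap.ext_on (s := {x | ∃ (m n : ℕ) (f : Fin m → H) (g : Fin n → H),
    x = creators f * annihilators g}) dense_normalOrdered ?_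
  rintro _ ⟨m, n, f, g, rfl⟩
  exact h m n f g

/-- The functional `φ` is a matrix element of the vacuum of the projection `P`, in which the range
of `P` is filled and its kernel is empty. -/
structure IsVacuumFunctional (P : H →L[ℂ] H) (φ : CAR H →L[ℂ] ℂ) : Prop where
  mul_a : ∀ x g, P g = 0 → φ (x * a g) = 0
  mul_star_a : ∀ x f, P f = f → φ (x * star (a f)) = 0
  a_mul : ∀ x f, P f = f → φ (a f * x) = 0
  star_a_mul : ∀ x g, P g = 0 → φ (star (a g) * x) = 0

namespace IsVacuumFunctional

variable {P : H →L[ℂ] H} {φ : CAR H →L[ℂ] ℂ}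

theorem apply_mul_a (hφ : IsVacuumFunctional P φ) (hP : IsIdempotentElem P) (x : CAR H) (g : H) :
    φ (x * a g) = φ (x * a (P g)) := by
  have h : P (g - P g) = 0 := by
    rw [map_sub, sub_eq_zero]
    exact (DFunLike.congr_fun hP g).symm
  have := hφ.mul_a x _ h
  rwa [a_sub, mul_sub, map_sub, sub_eq_zero] at this

theorem apply_creators_mul_annihilators [CompleteSpace H] (hφ : IsVacuumFunctional P φ)
    (hP : IsStarProjection P) {k n : ℕ} (f : Fin (k + 1) → H) (g : Fin (n + 1) → H) :
    φ (creators f * annihilators g) = (-1) ^ (n + k) * ∑ j : Fin (k + 1),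
      (-1) ^ (j : ℕ) * ⟪g 0, P (f j)⟫_ℂ *
        φ (creators (fun i => f (j.succAbove i)) * annihilators (fun i => g i.succ)) := by
  set G := annihilators fun i => g i.succ with hG
  have hPP : P (P (g 0)) = P (g 0) := DFunLike.congr_fun hP.isIdempotentElem (g 0)
  have hsymm : ∀ x, ⟪P (g 0), x⟫_ℂ = ⟪g 0, P x⟫_ℂ := fun x => by
    rw [← ContinuousLinearMap.adjoint_inner_right]
    rw [← ContinuousLinearMap.star_eq_adjoint, hP.isSelfAdjoint.star_eq]
  have h0 := hφ.a_mul (creators f * G) (P (g 0)) hPP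
  rw [← mul_assoc, a_mul_creators, add_mul, Finset.sum_mul, map_add, map_sum, smul_mul_assoc,
    map_smul] at h0
  simp only [smul_mul_assoc, map_smul, smul_eq_mul, hsymm] at h0
  rw [annihilators_succ, ← hG, ← mul_assoc, hφ.apply_mul_a hP.isIdempotentElem, mul_assoc, hG,
    annihilators_mul_a, ← hG, mul_smul_comm, map_smul, smul_eq_mul, ← mul_assoc]
  have hk : ((-1 : ℂ) ^ k) * (-1) ^ k = 1 := by rw [← mul_pow]; simp
  rw [pow_add]
  rw [pow_succ] at h0
  linear_combination (-(-1) ^ n * (-1) ^ k) * h0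
    - (-1) ^ n * φ (creators f * a (P (g 0)) * G) * hk

theorem apply_annihilators (hφ : IsVacuumFunctional P φ) (hP : IsIdempotentElem P) {n : ℕ}
    (g : Fin (n + 1) → H) : φ (annihilators g) = 0 := by
  rw [annihilators_succ, hφ.apply_mul_a hP, annihilators_mul_a, map_smul,
    hφ.a_mul _ _ (show P (P (g 0)) = _ from DFunLike.congr_fun hP (g 0)), smul_zero]

theorem apply_creators (hφ : IsVacuumFunctional P φ) (hP : IsIdempotentElem P) {m : ℕ}
    (f : Fin (m + 1) → H) : φ (creators f) = 0 := by
  have h : P (f 0 - P (f 0)) = 0 := by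
    rw [map_sub, sub_eq_zero]
    exact (DFunLike.congr_fun hP (f 0)).symm
  have h1 := hφ.star_a_mul (creators fun i => f i.succ) _ h
  rw [a_sub, star_sub, sub_mul, map_sub, sub_eq_zero] at h1
  rw [creators_succ, h1, star_a_mul_creators, map_smul,
    hφ.mul_star_a _ _ (show P (P (f 0)) = _ from DFunLike.congr_fun hP (f 0)), smul_zero]

variable [CompleteSpace H]

theorem apply_of_ne (hφ : IsVacuumFunctional P φ) (hP : IsStarProjection P) {m n : ℕ}
    (f : Fin m → H) (g : Fin n → H) (hmn : m ≠ n) : φ (creators f * annihilators g) = 0 := by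
  induction n generalizing m with
  | zero =>
    obtain ⟨m, rfl⟩ := Nat.exists_eq_succ_of_ne_zero hmn
    rw [annihilators_zero, mul_one, hφ.apply_creators hP.isIdempotentElem]
  | succ n ih =>
    cases m with
    | zero => rw [creators_zero, one_mul, hφ.apply_annihilators hP.isIdempotentElem]
    | succ k =>
      rw [hφ.apply_creators_mul_annihilators hP, Finset.sum_eq_zero, mul_zero]
      intro j _
      rw [ih _ _ (by omega), mul_zero]

/-- Wick's theorem. -/
theorem apply_eq_det (hφ : IsVacuumFunctional P φ) (hP : IsStarProjection P) {n : ℕ}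
    (f g : Fin n → H) : φ (creators f * annihilators g) =
      φ 1 * (Matrix.of fun i j => ⟪g i, P (f j)⟫_ℂ).det := by
  induction n with
  | zero => simp [annihilators_zero, creators_zero]
  | succ n ih =>
    rw [hφ.apply_creators_mul_annihilators hP, Matrix.det_succ_row_zero, Finset.mul_sum,
      Finset.mul_sum, ← two_mul, pow_mul]
    refine Finset.sum_congr rfl fun j _ => ?_
    rw [ih]
    simp only [even_two, Even.neg_pow, one_pow, one_mul, Matrix.of_apply]
    have : (Matrix.of fun i j => ⟪g i, P (f j)⟫_ℂ).submatrix Fin.succ j.succAbove =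
        Matrix.of fun i k => ⟪g i.succ, P (f (j.succAbove k))⟫_ℂ := rfl
    rw [this]
    ring

theorem isQuasiFree (hφ : IsVacuumFunctional P φ) (hP : IsStarProjection P) (h1 : φ 1 = 1) :
    IsQuasiFree P φ where
  eq_det n f g := by
    have := hφ.apply_eq_det hP f g
    rwa [h1, one_mul] at this
  eq_zero m n f g hmn := hφ.apply_of_ne hP f g hmn

end IsVacuumFunctional

end CAR

theorem IsQuasiFree.unique {H : Type u} [NormedAddCommGroup H] [InnerProductSpace ℂ H]
    {P : H →L[ℂ] H} {ω ω' : CAR H →L[ℂ] ℂ} (h : IsQuasiFree P ω) (h' : IsQuasiFree P ω') :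
    ω = ω' := by
  refine CAR.functional_ext fun m n f g => ?_
  by_cases hmn : m = n
  · subst hmn
    exact (h.eq_det m f g).trans (h'.eq_det m f g).symm
  · exact (h.eq_zero m n f g hmn).trans (h'.eq_zero m n f g hmn).symm

end

noncomputable section

/-! ### Weighted composition operators and the Jordan-Wigner representation -/

section WeightedComp

variable {X : Type*}

theorem memℓp_weightedComp (σ : Equiv.Perm X) {m : X → ℂ} (hm : ∀ B, ‖m B‖ ≤ 1)
    (x : lp (fun _ : X => ℂ) 2) : Memℓp (fun B => m B * x (σ B)) 2 := by
  have h2 : (0 : ℝ) < (2 : ℝ≥0∞).toReal := by norm_num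
  rw [memℓp_gen_iff h2]
  have hx := (σ.summable_iff).mpr ((memℓp_gen_iff h2).mp (lp.memℓp x))
  refine Summable.of_nonneg_of_le (fun _ => by positivity) (fun B => ?_) hx
  simp only [Function.comp, norm_mul]
  gcongr
  exact mul_le_of_le_one_left (norm_nonneg _) (hm B)

/-- The operator `(T x)(B) = m(B) x(σ(B))` on `ℓ²(X)`. -/
def weightedComp (σ : Equiv.Perm X) (m : X → ℂ) (hm : ∀ B, ‖m B‖ ≤ 1) :
    lp (fun _ : X => ℂ) 2 →L[ℂ] lp (fun _ : X => ℂ) 2 :=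
  LinearMap.mkContinuous
    { toFun := fun x => ⟨fun B => m B * x (σ B), memℓp_weightedComp σ hm x⟩
      map_add' := fun x y => lp.ext (funext fun B => mul_add (m B) (x (σ B)) (y (σ B)))
      map_smul' := fun r x => lp.ext (funext fun B => by simp; ring) } 1 fun x => by
    have h2 : (0 : ℝ) < (2 : ℝ≥0∞).toReal := by norm_num
    rw [one_mul]
    refine lp.norm_le_of_tsum_le h2 (norm_nonneg _) ?_
    rw [lp.norm_rpow_eq_tsum h2 x, ← σ.tsum_eq fun B => ‖x B‖ ^ _]
    have hx := (memℓp_gen_iff h2).mp (lp.memℓp x)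
    refine Summable.tsum_le_tsum (fun B => ?_)
      ((memℓp_gen_iff h2).mp (memℓp_weightedComp σ hm x)) (σ.summable_iff.mpr hx)
    simp only [LinearMap.coe_mk, AddHom.coe_mk, norm_mul]
    gcongr
    exact mul_le_of_le_one_left (norm_nonneg _) (hm B)

theorem weightedComp_apply (σ : Equiv.Perm X) (m : X → ℂ) (hm : ∀ B, ‖m B‖ ≤ 1)
    (x : lp (fun _ : X => ℂ) 2) (B : X) : weightedComp σ m hm x B = m B * x (σ B) := rfl

theorem star_weightedComp (σ : Equiv.Perm X) (m m' : X → ℂ) (hm : ∀ B, ‖m B‖ ≤ 1)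
    (hm' : ∀ B, ‖m' B‖ ≤ 1) (hσ : ∀ B, σ (σ B) = B) (h : ∀ B, m' (σ B) = star (m B)) :
    star (weightedComp σ m hm) = weightedComp σ m' hm' := by
  rw [ContinuousLinearMap.star_eq_adjoint, eq_comm, ContinuousLinearMap.eq_adjoint_iff]
  intro x y
  rw [lp.inner_eq_tsum, lp.inner_eq_tsum, ← σ.tsum_eq]
  refine tsum_congr fun B => ?_
  simp only [weightedComp_apply, hσ, h, RCLike.inner_apply, map_mul, Complex.star_def,
    Complex.conj_conj]
  ring

end WeightedComp

section JordanWigner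

variable {ι : Type*} [LinearOrder ι]

/-- Adding or removing the element `i`. -/
def toggle (i : ι) : Equiv.Perm (Finset ι) where
  toFun B := symmDiff B {i}
  invFun B := symmDiff B {i}
  left_inv _ := symmDiff_symmDiff_cancel_right _ _
  right_inv _ := symmDiff_symmDiff_cancel_right _ _

theorem toggle_toggle (i : ι) (B : Finset ι) : toggle i (toggle i B) = B :=
  symmDiff_symmDiff_cancel_right _ _

theorem toggle_comm (i j : ι) (B : Finset ι) : toggle i (toggle j B) = toggle j (toggle i B) :=
  symmDiff_right_comm _ _ _

theorem mem_toggle (i j : ι) (B : Finset ι) :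
    j ∈ toggle i B ↔ (if j = i then j ∉ B else j ∈ B) := by
  simp only [toggle, Equiv.coe_fn_mk, Finset.mem_symmDiff, Finset.mem_singleton]
  split_ifs with h <;> simp [h]

/-- The sign `(-1) ^ #{j ∈ B | j < i}`. -/
def jwSign (i : ι) (B : Finset ι) : ℂ := (-1) ^ (B.filter (· < i)).card

theorem jwSign_mul_self (i : ι) (B : Finset ι) : jwSign i B * jwSign i B = 1 := by
  rw [jwSign, ← mul_pow]; simp

theorem norm_jwSign (i : ι) (B : Finset ι) : ‖jwSign i B‖ = 1 := by simp [jwSign]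

theorem star_jwSign (i : ι) (B : Finset ι) : star (jwSign i B) = jwSign i B := by simp [jwSign]

theorem jwSign_toggle (i j : ι) (B : Finset ι) :
    jwSign j (toggle i B) = if i < j then -jwSign j B else jwSign j B := by
  have key : ∀ B : Finset ι, i ∉ B →
      jwSign j (toggle i B) = if i < j then -jwSign j B else jwSign j B := by
    intro B hB
    have : toggle i B = insert i B := by
      ext k
      rw [mem_toggle]
      split_ifs with h <;> simp [h, hB]
    rw [this, jwSign, Finset.filter_insert]
    split_ifs with h
    · rw [Finset.card_insert_of_notMem (by simp [hB]), pow_succ, jwSign]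
      ring
    · rfl
  by_cases hB : i ∈ B
  · have h := key (toggle i B) (by simp [mem_toggle, hB])
    rw [toggle_toggle] at h
    split_ifs at h ⊢ with hij
    · rw [h, neg_neg]
    · exact h.symm
  · exact key B hB

/-- The Jordan-Wigner annihilation operators on `ℓ²(Finset ι)`. -/
def jwAnnihilator (i : ι) :
    lp (fun _ : Finset ι => ℂ) 2 →L[ℂ] lp (fun _ : Finset ι => ℂ) 2 :=
  weightedComp (toggle i) (fun B => if i ∈ B then 0 else jwSign i B) fun B => by
    split_ifs <;> simp [norm_jwSign]

/-- The Jordan-Wigner creation operators on `ℓ²(Finset ι)`. -/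
def jwCreator (i : ι) :
    lp (fun _ : Finset ι => ℂ) 2 →L[ℂ] lp (fun _ : Finset ι => ℂ) 2 :=
  weightedComp (toggle i) (fun B => if i ∈ B then jwSign i B else 0) fun B => by
    split_ifs <;> simp [norm_jwSign]

theorem star_jwAnnihilator (i : ι) : star (jwAnnihilator i) = jwCreator i := by
  refine star_weightedComp _ _ _ _ _ (toggle_toggle i) fun B => ?_
  simp only [mem_toggle, jwSign_toggle]
  by_cases h : i ∈ B <;> simp [h, star_jwSign]

theorem jwAnnihilator_anticomm (i j : ι) :
    jwAnnihilator i * jwAnnihilator j + jwAnnihilator j * jwAnnihilator i = 0 := by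
  ext x B
  simp only [jwAnnihilator, add_apply, mul_apply_eq_comp,
    lp.coeFn_add, Pi.add_apply, weightedComp_apply, mem_toggle, jwSign_toggle, toggle_comm i j,
    zero_apply, lp.coeFn_zero, Pi.zero_apply]
  rcases lt_trichotomy i j with h | h | h
  · by_cases hi : i ∈ B <;> by_cases hj : j ∈ B <;>
      simp [h, h.not_gt, h.ne, h.ne', hi, hj]
    ring
  · subst h
    by_cases hi : i ∈ B <;> simp [hi]
  · by_cases hi : i ∈ B <;> by_cases hj : j ∈ B <;>
      simp [h, h.not_gt, h.ne, h.ne', hi, hj]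
    ring

theorem jwAnnihilator_anticomm_star (i j : ι) :
    jwAnnihilator i * star (jwAnnihilator j) + star (jwAnnihilator j) * jwAnnihilator i =
      if i = j then 1 else 0 := by
  rw [star_jwAnnihilator]
  ext x B
  simp only [jwAnnihilator, jwCreator, add_apply,
    mul_apply_eq_comp,
    lp.coeFn_add, Pi.add_apply, weightedComp_apply, mem_toggle, jwSign_toggle, toggle_comm i j]
  rcases lt_trichotomy i j with h | h | h
  · by_cases hi : i ∈ B <;> by_cases hj : j ∈ B <;>
      simp [h, h.not_gt, h.ne, h.ne', hi, hj]
    ring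
  · subst h
    by_cases hi : i ∈ B <;> simp [hi, toggle_toggle, ← mul_assoc, jwSign_mul_self]
  · by_cases hi : i ∈ B <;> by_cases hj : j ∈ B <;>
      simp [h, h.not_gt, h.ne, h.ne', hi, hj]
    ring

theorem jwAnnihilator_vacuum (i : ι) : jwAnnihilator i (lp.single 2 ∅ 1) = 0 := by
  ext B
  simp only [jwAnnihilator, weightedComp_apply, lp.coeFn_zero, Pi.zero_apply]
  split_ifs with h
  · simp
  · rw [lp.single_apply_ne, mul_zero]
    intro h0
    have : i ∈ toggle i B := by simp [mem_toggle, h]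
    simp [h0] at this

end JordanWigner

/-! ### CAR systems from orthonormal bases -/

section OfBasis

theorem CStarAlgebra.norm_sq_le_of_anticomm {A : Type*} [CStarAlgebra A] {x : A} {r : ℂ}
    (hsq : x * x = 0) (h : x * star x + star x * x = r • 1) : ‖x‖ ^ 2 ≤ ‖r‖ := by
  have hx : star (star x * x) * (star x * x) = r • (star x * x) := by
    calc star (star x * x) * (star x * x)
        = star x * (x * star x + star x * x) * x - star x * star x * (x * x) := by
          simp only [star_mul, star_star]; noncomm_ring
      _ = r • (star x * x) := by
          rw [h, hsq]; simp
  have hn := congrArg norm hx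
  rw [CStarRing.norm_star_mul_self, norm_smul, CStarRing.norm_star_mul_self] at hn
  rcases eq_or_ne ‖x‖ 0 with h0 | h0
  · rw [h0]; simp
  · have := mul_right_cancel₀ (mul_ne_zero h0 h0) hn
    rw [sq, this]

variable {H : Type u} [NormedAddCommGroup H] [InnerProductSpace ℂ H]
  {ι : Type*} {A : Type*} [CStarAlgebra A]

variable (e : HilbertBasis ι ℂ H) (c : ι → A)

theorem summable_inner_smul [DecidableEq ι] (hcc : ∀ i j, c i * c j + c j * c i = 0)
    (hcs : ∀ i j, c i * star (c j) + star (c j) * c i = if i = j then 1 else 0) (f : H) :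
    Summable fun i => ⟪f, e i⟫_ℂ • c i := by
  have hb : ∀ s : Finset ι, ‖∑ i ∈ s, ⟪f, e i⟫_ℂ • c i‖ ^ 2 ≤ ∑ i ∈ s, ‖⟪f, e i⟫_ℂ‖ ^ 2 := by
    intro s
    have h0 : (∑ i ∈ s, ⟪f, e i⟫_ℂ • c i) * ∑ i ∈ s, ⟪f, e i⟫_ℂ • c i = 0 := by
      have h2 : (∑ i ∈ s, ⟪f, e i⟫_ℂ • c i) * (∑ i ∈ s, ⟪f, e i⟫_ℂ • c i)
          + (∑ i ∈ s, ⟪f, e i⟫_ℂ • c i) * (∑ i ∈ s, ⟪f, e i⟫_ℂ • c i) = 0 := by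
        simp only [Finset.sum_mul_sum, smul_mul_smul_comm]
        nth_rw 2 [Finset.sum_comm]
        rw [← Finset.sum_add_distrib]
        refine Finset.sum_eq_zero fun i _ => ?_
        rw [← Finset.sum_add_distrib]
        refine Finset.sum_eq_zero fun j _ => ?_
        rw [mul_comm ⟪f, e j⟫_ℂ, ← smul_add, hcc, smul_zero]
      rw [← two_smul ℂ] at h2
      exact (smul_eq_zero.mp h2).resolve_left two_ne_zero
    refine (CStarAlgebra.norm_sq_le_of_anticomm h0
      (r := ∑ i ∈ s, ⟪f, e i⟫_ℂ * star ⟪f, e i⟫_ℂ) ?_).trans ?_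
    · simp only [star_sum, Finset.sum_mul_sum, star_smul, smul_mul_smul_comm]
      nth_rw 2 [Finset.sum_comm]
      rw [← Finset.sum_add_distrib, Finset.sum_smul]
      refine Finset.sum_congr rfl fun i hi => ?_
      rw [← Finset.sum_add_distrib, Finset.sum_eq_single i]
      · rw [mul_comm (star _), ← smul_add, hcs, if_pos rfl]
      · intro j _ hj
        rw [mul_comm (star _), ← smul_add, hcs, if_neg hj.symm, smul_zero]
      · exact fun h => absurd hi h
    · refine (norm_sum_le _ _).trans (le_of_eq (Finset.sum_congr rfl fun i _ => ?_))
      rw [norm_mul, norm_star, sq]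
  have hs : Summable fun i => ‖⟪f, e i⟫_ℂ‖ ^ 2 := by
    have := (e.summable_inner_mul_inner f f).norm
    refine this.congr fun i => ?_
    rw [norm_mul, norm_inner_symm (e i), sq]
  rw [summable_iff_vanishing_norm] at hs ⊢
  intro ε hε
  obtain ⟨s, hs⟩ := hs (ε ^ 2) (by positivity)
  refine ⟨s, fun t ht => ?_⟩
  have h1 := (hb t).trans_lt ((le_abs_self _).trans_lt (hs t ht))
  exact lt_of_pow_lt_pow_left₀ 2 hε.le h1

/-- The CAR system with `a(eᵢ) = cᵢ` for an orthonormal basis `(eᵢ)`. -/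
def CARSystem.ofBasis [DecidableEq ι] {A : Type u} [CStarAlgebra A] [Nontrivial A] (c : ι → A)
    (hcc : ∀ i j, c i * c j + c j * c i = 0)
    (hcs : ∀ i j, c i * star (c j) + star (c j) * c i = if i = j then 1 else 0) :
    CARSystem H where
  Alg := A
  a :=
    { toFun := fun f => ∑' i, ⟪f, e i⟫_ℂ • c i
      map_add' := fun f g => by
        rw [← (summable_inner_smul e c hcc hcs f).tsum_add (summable_inner_smul e c hcc hcs g)]
        simp only [inner_add_left, add_smul]
      map_smul' := fun z f => by
        rw [← (summable_inner_smul e c hcc hcs f).tsum_const_smul]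
        simp only [inner_smul_left, mul_smul] }
  anticomm f g := by
    have hf := (summable_inner_smul e c hcc hcs f).hasSum
    have hg := (summable_inner_smul e c hcc hcs g).hasSum
    refine tendsto_nhds_unique ((Tendsto.mul hf hg).add (Tendsto.mul hg hf)) ?_
    refine tendsto_const_nhds.congr fun s => ?_
    simp only [Finset.sum_mul_sum, smul_mul_smul_comm]
    nth_rw 2 [Finset.sum_comm]
    rw [← Finset.sum_add_distrib]
    refine (Finset.sum_eq_zero fun i _ => ?_).symm
    rw [← Finset.sum_add_distrib]
    refine Finset.sum_eq_zero fun j _ => ?_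
    rw [mul_comm ⟪g, e j⟫_ℂ, ← smul_add, hcc, smul_zero]
  anticomm_star f g := by
    have hf := (summable_inner_smul e c hcc hcs f).hasSum
    have hg := (summable_inner_smul e c hcc hcs g).hasSum.star
    refine tendsto_nhds_unique ((Tendsto.mul hf hg).add (Tendsto.mul hg hf)) ?_
    have hfg : Tendsto (fun s : Finset ι => (∑ i ∈ s, ⟪f, e i⟫_ℂ * ⟪e i, g⟫_ℂ) • (1 : A))
      (SummationFilter.unconditional ι).filter (𝓝 (⟪f, g⟫_ℂ • 1)) :=
        Tendsto.smul_const (e.hasSum_inner_mul_inner f g) 1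
    refine hfg.congr fun s => ?_
    simp only [Finset.sum_mul_sum, star_smul, smul_mul_smul_comm]
    nth_rw 2 [Finset.sum_comm]
    rw [← Finset.sum_add_distrib, Finset.sum_smul]
    refine Finset.sum_congr rfl fun i hi => ?_
    rw [← Finset.sum_add_distrib, Finset.sum_eq_single i]
    · rw [mul_comm (star _), ← smul_add, hcs, if_pos rfl, Complex.star_def, inner_conj_symm]
    · intro j _ hj
      rw [mul_comm (star _), ← smul_add, hcs, if_neg hj.symm, smul_zero]
    · exact fun h => absurd hi h

end OfBasis

end

noncomputable section

/-! ### Existence and purity of quasi-free states -/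

section Existence

variable {H : Type u} [NormedAddCommGroup H] [InnerProductSpace ℂ H]

theorem IsStarProjection.apply_apply {H : Type*} [NormedAddCommGroup H] [InnerProductSpace ℂ H]
    [CompleteSpace H] {P : H →L[ℂ] H} (hP : IsStarProjection P) (x : H) : P (P x) = P x :=
  DFunLike.congr_fun hP.isIdempotentElem x

theorem IsStarProjection.inner_apply_left {H : Type*} [NormedAddCommGroup H]
    [InnerProductSpace ℂ H] [CompleteSpace H] {P : H →L[ℂ] H} (hP : IsStarProjection P) (x y : H) :
    ⟪P x, y⟫_ℂ = ⟪x, P y⟫_ℂ := by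
  rw [← ContinuousLinearMap.adjoint_inner_right, ← ContinuousLinearMap.star_eq_adjoint,
    hP.isSelfAdjoint.star_eq]

/-- Every projection has an orthonormal eigenbasis. -/
theorem IsStarProjection.exists_hilbertBasis [CompleteSpace H] {P : H →L[ℂ] H}
    (hP : IsStarProjection P) :
    ∃ (w : Set H) (b : HilbertBasis w ℂ H), ∀ i, P (b i) = b i ∨ P (b i) = 0 := by
  have hK : IsClosed (P.range : Set H) := by
    have : (P.range : Set H) = {x | P x = x} := by
      ext x
      exact ⟨by rintro ⟨y, rfl⟩; exact hP.apply_apply y, fun h => ⟨x, h⟩⟩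
    rw [this]
    exact isClosed_eq P.continuous continuous_id
  have : CompleteSpace P.range := hK.completeSpace_coe
  have hfix : ∀ x : P.range, P x = x := by
    rintro ⟨_, y, rfl⟩
    exact hP.apply_apply y
  obtain ⟨w₀, b₀, hb₀⟩ := _root_.exists_hilbertBasis ℂ P.range
  have hs : Orthonormal ℂ ((↑) : (Subtype.val '' w₀ : Set H) → H) := by
    have h1 : Orthonormal ℂ fun i : w₀ => ((b₀ i : P.range) : H) :=
      b₀.orthonormal.comp_linearIsometry P.range.subtypeₗᵢ
    have h2 : (Subtype.val '' w₀ : Set H) = Set.range fun i : w₀ => ((b₀ i : P.range) : H) := by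
      ext x
      simp [hb₀]
    rw [h2]
    exact h1.toSubtypeRange
  obtain ⟨w, b, hw, hb⟩ := hs.exists_hilbertBasis_extension
  refine ⟨w, b, fun i => ?_⟩
  by_cases hi : (i : H) ∈ (Subtype.val '' w₀ : Set H)
  · obtain ⟨x, -, hx⟩ := hi
    left
    rw [hb, ← hx]
    exact hfix x
  · right
    have h0 : b₀.repr ⟨P (b i), b i, rfl⟩ = 0 := by
      ext j
      rw [b₀.repr_apply_apply, Submodule.coe_inner, ← hP.inner_apply_left, hfix]
      have hj : ((b₀ j : P.range) : H) ∈ w := hw ⟨j, j.2, by rw [hb₀]⟩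
      have hne : (⟨_, hj⟩ : w) ≠ i := by
        rintro rfl
        exact hi ⟨j, j.2, by simp [hb₀]⟩
      have := b.orthonormal.2 hne
      rwa [hb] at this ⊢
    have h1 := (b₀.repr.map_eq_zero_iff).mp h0
    exact congrArg Subtype.val h1

namespace CAR

theorem isVacuumFunctional_of_state {P : H →L[ℂ] H} {ω : CAR H →L[ℂ] ℂ}
    (hω : ω ∈ stateSpace (CAR H)) (h0 : ∀ g, P g = 0 → ω (star (a g) * a g) = 0)
    (h1 : ∀ f, P f = f → ω (a f * star (a f)) = 0) : IsVacuumFunctional P ω where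
  mul_a x g hg := (stateSpace_apply_eq_zero hω (h0 g hg) x).1
  mul_star_a x f hf :=
    (stateSpace_apply_eq_zero hω (x := star (a f)) (by simpa using h1 f hf) x).1
  a_mul x f hf := by
    simpa using (stateSpace_apply_eq_zero hω (x := star (a f)) (by simpa using h1 f hf) x).2
  star_a_mul x g hg := (stateSpace_apply_eq_zero hω (h0 g hg) x).2

/-- The vector state of a unit vector `v` in a representation of the CAR algebra. -/
def vectorState {E : Type*} [NormedAddCommGroup E] [InnerProductSpace ℂ E] [CompleteSpace E]
    (π : CAR H →⋆ₐ[ℂ] (E →L[ℂ] E)) (v : E) : CAR H →L[ℂ] ℂ where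
  toFun x := ⟪v, π x v⟫_ℂ
  map_add' x y := by simp
  map_smul' r x := by simp
  cont := continuous_const.inner (π.continuous_of_cstar.clm_apply continuous_const)

theorem vectorState_mem {E : Type*} [NormedAddCommGroup E] [InnerProductSpace ℂ E]
    [CompleteSpace E] (π : CAR H →⋆ₐ[ℂ] (E →L[ℂ] E)) {v : E} (hv : ‖v‖ = 1) :
    vectorState π v ∈ stateSpace (CAR H) := by
  refine ⟨fun x => ?_, ?_⟩
  · show 0 ≤ ⟪v, π (star x * x) v⟫_ℂ
    rw [map_mul, map_star, mul_apply_eq_comp, ContinuousLinearMap.star_eq_adjoint,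
      ContinuousLinearMap.adjoint_inner_right, inner_self_eq_norm_sq_to_K]
    simp only [Complex.coe_algebraMap]
    exact_mod_cast sq_nonneg ‖π x v‖
  · show ⟪v, π 1 v⟫_ℂ = 1
    simp [inner_self_eq_norm_sq_to_K, hv]

theorem vectorState_star_mul_self {E : Type*} [NormedAddCommGroup E] [InnerProductSpace ℂ E]
    [CompleteSpace E] (π : CAR H →⋆ₐ[ℂ] (E →L[ℂ] E)) {v : E} {x : CAR H} (hx : π x v = 0) :
    vectorState π v (star x * x) = 0 := by
  show ⟪v, π (star x * x) v⟫_ℂ = 0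
  rw [map_mul, mul_apply_eq_comp, hx, map_zero, inner_zero_right]

theorem exists_vacuum_state_of_basis [CompleteSpace H] {P : H →L[ℂ] H} (hP : IsStarProjection P)
    {ι : Type u} [LinearOrder ι] (e : HilbertBasis ι ℂ H)
    (he : ∀ i, P (e i) = e i ∨ P (e i) = 0) :
    ∃ ω ∈ stateSpace (CAR H), IsVacuumFunctional P ω := by
  classical
  let c : ι → (lp (fun _ : Finset ι => ℂ) 2 →L[ℂ] lp (fun _ : Finset ι => ℂ) 2) :=
    fun i => if P (e i) = e i then star (jwAnnihilator i) else jwAnnihilator i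
  have hss : ∀ i j : ι, star (jwAnnihilator i) * star (jwAnnihilator j) +
      star (jwAnnihilator j) * star (jwAnnihilator i) = 0 := fun i j => by
    have := congrArg star (jwAnnihilator_anticomm j i)
    simpa using this
  have h2 : ∀ i j : ι, star (jwAnnihilator i) * jwAnnihilator j +
      jwAnnihilator j * star (jwAnnihilator i) = if i = j then 1 else 0 := fun i j => by
    rw [add_comm, jwAnnihilator_anticomm_star]
    simp only [eq_comm]
  have hne : ∀ i j : ι, ¬ (P (e i) = e i) → P (e j) = e j → i ≠ j := by
    rintro i _ h1 h2 rfl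
    exact h1 h2
  have hcc : ∀ i j, c i * c j + c j * c i = 0 := by
    intro i j
    simp only [c]
    split_ifs with hi hj hj
    · exact hss i j
    · rw [h2, if_neg (hne j i hj hi).symm]
    · rw [jwAnnihilator_anticomm_star, if_neg (hne i j hi hj)]
    · exact jwAnnihilator_anticomm i j
  have hcs : ∀ i j, c i * star (c j) + star (c j) * c i = if i = j then 1 else 0 := by
    intro i j
    simp only [c]
    by_cases hi : P (e i) = e i <;> by_cases hj : P (e j) = e j
    · rw [if_pos hi, if_pos hj, star_star, h2]
    · rw [if_pos hi, if_neg hj, hss, if_neg (hne j i hj hi).symm]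
    · rw [if_neg hi, if_pos hj, star_star, jwAnnihilator_anticomm, if_neg (hne i j hi hj)]
    · rw [if_neg hi, if_neg hj, jwAnnihilator_anticomm_star]
  let Ω : lp (fun _ : Finset ι => ℂ) 2 := lp.single 2 ∅ 1
  have hΩ : ‖Ω‖ = 1 := by
    rw [lp.norm_single (by norm_num)]
    simp
  have : Nontrivial (lp (fun _ : Finset ι => ℂ) 2) :=
    ⟨Ω, 0, fun h => by rw [h, norm_zero] at hΩ; exact zero_ne_one hΩ⟩
  let S : CARSystem H := CARSystem.ofBasis e c hcc hcs
  let π : CAR H →⋆ₐ[ℂ] (lp (fun _ : Finset ι => ℂ) 2 →L[ℂ] lp (fun _ : Finset ι => ℂ) 2) :=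
    CAR.eval S
  have hπ : ∀ f, HasSum (fun i => ⟪f, e i⟫_ℂ • c i) (π (a f)) := fun f =>
    (summable_inner_smul e c hcc hcs f).hasSum
  have happ : ∀ {T : ι → (lp (fun _ : Finset ι => ℂ) 2 →L[ℂ] lp (fun _ : Finset ι => ℂ) 2)} {T₀},
      HasSum T T₀ → (∀ i, T i Ω = 0) → T₀ Ω = 0 := by
    intro T T₀ h h0
    have h3 := h.mapL (ContinuousLinearMap.apply ℂ _ Ω)
    refine h3.unique ?_
    simp [h0, hasSum_zero]
  refine ⟨vectorState π Ω, vectorState_mem π hΩ, isVacuumFunctional_of_state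
    (vectorState_mem π hΩ) (fun g hg => vectorState_star_mul_self π ?_) fun f hf => ?_⟩
  · refine happ (hπ g) fun i => ?_
    by_cases hi : P (e i) = e i
    · rw [← hi, ← hP.inner_apply_left, hg, inner_zero_left, zero_smul]
      rfl
    · simp only [c, if_neg hi, smul_apply, jwAnnihilator_vacuum, smul_zero, Ω]
  · have : π (star (a f)) Ω = 0 := by
      rw [map_star]
      refine happ (hπ f).star fun i => ?_
      rcases he i with hi | hi
      · simp only [c, if_pos hi, star_smul, star_star, smul_apply, jwAnnihilator_vacuum, Ω,
          smul_zero]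
      · rw [← hf, hP.inner_apply_left, hi, inner_zero_right, zero_smul, star_zero]
        rfl
    simpa using vectorState_star_mul_self π this

theorem exists_vacuum_state [CompleteSpace H] {P : H →L[ℂ] H} (hP : IsStarProjection P) :
    ∃ ω ∈ stateSpace (CAR H), IsVacuumFunctional P ω := by
  obtain ⟨ι, e, he⟩ := hP.exists_hilbertBasis
  classical
  let : LinearOrder ι := linearOrderOfSTO WellOrderingRel
  exact exists_vacuum_state_of_basis hP e he

end CAR

variable [CompleteSpace H] {P : H →L[ℂ] H} {ω : CAR H →L[ℂ] ℂ}

theorem existsUnique_isQuasiFree (hP : IsStarProjection P) :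
    ∃! ω : CAR H →L[ℂ] ℂ, IsQuasiFree P ω := by
  obtain ⟨ω, hω, h⟩ := CAR.exists_vacuum_state hP
  exact ⟨ω, h.isQuasiFree hP hω.2, fun ω' h' => h'.unique (h.isQuasiFree hP hω.2)⟩

namespace IsQuasiFree

theorem mem_stateSpace (hP : IsStarProjection P) (h : IsQuasiFree P ω) :
    ω ∈ stateSpace (CAR H) := by
  obtain ⟨ω', hω, h'⟩ := CAR.exists_vacuum_state hP
  rwa [h.unique (h'.isQuasiFree hP hω.2)]

theorem isVacuumFunctional (hP : IsStarProjection P) (h : IsQuasiFree P ω) :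
    CAR.IsVacuumFunctional P ω := by
  obtain ⟨ω', hω, h'⟩ := CAR.exists_vacuum_state hP
  rwa [h.unique (h'.isQuasiFree hP hω.2)]

omit [CompleteSpace H] in
theorem apply_one (h : IsQuasiFree P ω) : ω 1 = 1 := by
  simpa using h.eq_det 0 Fin.elim0 Fin.elim0

omit [CompleteSpace H] in
theorem apply_star_a_mul_a (h : IsQuasiFree P ω) (f g : H) :
    ω (star (CAR.a f) * CAR.a g) = ⟪g, P f⟫_ℂ := by
  simpa using h.eq_det 1 (fun _ => f) (fun _ => g)

omit [CompleteSpace H] in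
theorem apply_a_mul_star_a (h : IsQuasiFree P ω) (f g : H) :
    ω (CAR.a f * star (CAR.a g)) = ⟪f, g⟫_ℂ - ⟪f, P g⟫_ℂ := by
  rw [CAR.a_mul_star_a, map_sub, map_smul, h.apply_one, h.apply_star_a_mul_a]
  simp

omit [CompleteSpace H] in
theorem apply_a_mul_a (h : IsQuasiFree P ω) (f g : H) : ω (CAR.a f * CAR.a g) = 0 := by
  simpa using h.eq_zero 0 2 Fin.elim0 ![g, f] (by norm_num)

omit [CompleteSpace H] in
theorem apply_star_a_mul_star_a (h : IsQuasiFree P ω) (f g : H) :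
    ω (star (CAR.a f) * star (CAR.a g)) = 0 := by
  simpa using h.eq_zero 2 0 ![f, g] Fin.elim0 (by norm_num)

/-- A state whose two-point function is a projection is quasi-free. -/
theorem of_twoPoint (hP : IsStarProjection P) (hω : ω ∈ stateSpace (CAR H))
    (h : ∀ f, ω (star (CAR.a f) * CAR.a f) = ⟪f, P f⟫_ℂ) : IsQuasiFree P ω := by
  refine (CAR.isVacuumFunctional_of_state hω (fun g hg => ?_) fun f hf => ?_).isQuasiFree hP hω.2
  · rw [h, hg, inner_zero_right]
  · rw [CAR.a_mul_star_a, map_sub, map_smul, hω.2, h, hf]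
    simp

theorem mem_pureStates (hP : IsStarProjection P) (h : IsQuasiFree P ω) :
    ω ∈ pureStates (CAR H) := by
  refine ⟨h.mem_stateSpace hP, ?_⟩
  intro ω₁ h₁ ω₂ h₂ hω
  obtain ⟨s, t, hs, ht, -, hst⟩ := hω
  have hv := h.isVacuumFunctional hP
  have key : ∀ x : CAR H, ω (star x * x) = 0 → ω₁ (star x * x) = 0 := by
    intro x hx
    rw [← hst] at hx
    simp only [add_apply, smul_apply] at hx
    have p1 : 0 ≤ s • ω₁ (star x * x) := smul_nonneg hs.le (h₁.1 x)
    have p2 : 0 ≤ t • ω₂ (star x * x) := smul_nonneg ht.le (h₂.1 x)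
    have := ((add_eq_zero_iff_of_nonneg p1 p2).mp hx).1
    exact (smul_eq_zero.mp this).resolve_left hs.ne'
  refine (((CAR.isVacuumFunctional_of_state h₁ (fun g hg => ?_) fun f hf => ?_).isQuasiFree hP
    h₁.2).unique h)
  · exact key _ (hv.mul_a _ _ hg)
  · simpa using key (star (CAR.a f)) (by simpa using hv.mul_star_a (CAR.a f) f hf)

theorem invariant (h : IsQuasiFree P ω) (hP : IsStarProjection P) :
    (CAR.charge H).Invariant ω := by
  intro t
  let φ : CAR H →⋆ₐ[ℂ] CAR H := ((CAR.charge H).aut t : CAR H →⋆ₐ[ℂ] CAR H)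
  let ω' : CAR H →L[ℂ] ℂ := ω.comp ⟨φ.toAlgHom.toLinearMap, φ.continuous_of_cstar⟩
  have hω' : ∀ x, ω' x = ω ((CAR.charge H).aut t x) := fun _ => rfl
  have hst := h.mem_stateSpace hP
  have hs : ω' ∈ stateSpace (CAR H) := by
    refine ⟨fun x => ?_, ?_⟩
    · rw [hω', map_mul, map_star]
      exact hst.1 _
    · rw [hω', map_one, hst.2]
  have : IsQuasiFree P ω' := by
    refine of_twoPoint hP hs fun f => ?_
    rw [hω', map_mul, CAR.charge_a, CAR.charge_star_a, smul_mul_smul_comm, ← Complex.exp_add,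
      add_neg_cancel, Complex.exp_zero, one_smul, h.apply_star_a_mul_a]
  intro x
  rw [← hω', this.unique h]

/-- If `v` implements a symmetry of a quasi-free state, then the vacuum is an eigenvector
of `v`. -/
theorem apply_mul_eq (h : IsQuasiFree P ω) (hP : IsStarProjection P) {v : CAR H}
    (hv : ∀ y, ω (star v * y * v) = ω y) (x : CAR H) :
    ω (x * v) = ω v * ω x ∧ ω (star v * x) = ω (star v) * ω x := by
  have hω := h.mem_stateSpace hP
  have hvac := h.isVacuumFunctional hP
  have hz : ∀ z, ω (star z * z) = 0 → ω (star (z * v) * (z * v)) = 0 := by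
    intro z hz
    rw [star_mul, mul_assoc, ← mul_assoc (star z), ← mul_assoc, hv, hz]
  have hz0 : ∀ g, P g = 0 → ω (star (CAR.a g * v) * (CAR.a g * v)) = 0 := fun g hg =>
    hz _ (hvac.mul_a _ _ hg)
  have hz1 : ∀ f, P f = f → ω (star (star (CAR.a f) * v) * (star (CAR.a f) * v)) = 0 :=
    fun f hf => hz _ (hvac.mul_star_a _ _ hf)
  have key : ∀ φ : CAR H →L[ℂ] ℂ, CAR.IsVacuumFunctional P φ → ∀ x, φ x = φ 1 * ω x := by
    intro φ hφ
    have : φ = φ 1 • ω := by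
      refine CAR.functional_ext fun m n f g => ?_
      simp only [smul_apply, smul_eq_mul]
      by_cases hmn : m = n
      · subst hmn
        rw [hφ.apply_eq_det hP, hvac.apply_eq_det hP, h.apply_one, one_mul]
      · rw [hφ.apply_of_ne hP f g hmn, hvac.apply_of_ne hP f g hmn, mul_zero]
    intro x
    exact DFunLike.congr_fun this x
  constructor
  · have := key (ω.comp ((ContinuousLinearMap.mul ℂ (CAR H)).flip v)) ?_ x
    · simpa using this
    · constructor
      · intro x g hg
        simpa [mul_assoc] using (stateSpace_apply_eq_zero hω (hz0 g hg) x).1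
      · intro x f hf
        simpa [mul_assoc] using (stateSpace_apply_eq_zero hω (hz1 f hf) x).1
      · intro x f hf
        simpa [mul_assoc] using hvac.a_mul (x * v) f hf
      · intro x g hg
        simpa [mul_assoc] using hvac.star_a_mul (x * v) g hg
  · have := key (ω.comp (ContinuousLinearMap.mul ℂ (CAR H) (star v))) ?_ x
    · simpa using this
    · constructor
      · intro x g hg
        simpa [mul_assoc] using hvac.mul_a (star v * x) g hg
      · intro x f hf
        simpa [mul_assoc] using hvac.mul_star_a (star v * x) f hf
      · intro x f hf
        simpa [mul_assoc] using (stateSpace_apply_eq_zero hω (hz1 f hf) x).2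
      · intro x g hg
        simpa [mul_assoc] using (stateSpace_apply_eq_zero hω (hz0 g hg) x).2

end IsQuasiFree

end Existence

end

noncomputable section

/-! ### Differentiable elements of a flow -/

section Flow

variable {A : Type*} [CStarAlgebra A]

theorem norm_le_one_of_mem_unitary {u : A} (hu : u ∈ unitary A) : ‖u‖ ≤ 1 := by
  rcases subsingleton_or_nontrivial A with h | h
  · rw [Subsingleton.elim u 0]
    simp
  · exact (CStarRing.norm_of_mem_unitary hu).le

/-- The functional `x ↦ ω(u* x u)`. -/
def conjFunctional (ω : A →L[ℂ] ℂ) (u : A) : A →L[ℂ] ℂ :=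
  ω.comp ((ContinuousLinearMap.mul ℂ A (star u)).comp ((ContinuousLinearMap.mul ℂ A).flip u))

theorem conjFunctional_apply (ω : A →L[ℂ] ℂ) (u x : A) :
    conjFunctional ω u x = ω (star u * x * u) := by
  simp [conjFunctional, mul_assoc]

theorem conjFunctional_mem_stateSpace {ω : A →L[ℂ] ℂ} (hω : ω ∈ stateSpace A) {u : A}
    (hu : u ∈ unitary A) : conjFunctional ω u ∈ stateSpace A := by
  refine ⟨fun x => ?_, ?_⟩
  · rw [conjFunctional_apply]
    have := hω.1 (x * u)
    rwa [star_mul, mul_assoc, ← mul_assoc (star x), ← mul_assoc] at this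
  · rw [conjFunctional_apply, mul_one, Unitary.star_mul_self_of_mem hu, hω.2]

namespace AutFlow

variable (ρ : AutFlow A)

/-- The automorphism at time `t` as a continuous linear map. -/
def autL (t : ℝ) : A →L[ℂ] A where
  toLinearMap := (ρ.aut t : A →⋆ₐ[ℂ] A).toAlgHom.toLinearMap
  cont := (ρ.aut t : A →⋆ₐ[ℂ] A).continuous_of_cstar

theorem norm_aut_le (t : ℝ) (x : A) : ‖ρ.aut t x‖ ≤ ‖x‖ :=
  NonUnitalStarAlgHom.norm_apply_le (ρ.aut t : A →⋆ₐ[ℂ] A) x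

theorem aut_neg_aut (t : ℝ) (x : A) : ρ.aut t (ρ.aut (-t) x) = x := by
  rw [← ρ.aut_add, add_neg_cancel, ρ.aut_zero]

/-- `x` is differentiable along `ρ` with derivative `d`. -/
def HasOrbitDeriv (x d : A) : Prop := HasDerivAt (fun t => ρ.aut t x) d 0

variable {ρ}

theorem HasOrbitDeriv.hasGenerator {x d : A} (h : ρ.HasOrbitDeriv x d) : ρ.HasGenerator x d := by
  have h := hasDerivAt_iff_tendsto_slope_zero.mp h
  simp only [zero_add, ρ.aut_zero] at h
  exact h.mono_left (nhdsWithin_mono _ fun t ht => (Set.mem_Ioi.mp ht).ne')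

theorem HasOrbitDeriv.mem_domain {x d : A} (h : ρ.HasOrbitDeriv x d) : x ∈ ρ.domain :=
  ⟨d, h.hasGenerator⟩

theorem hasOrbitDeriv_one : ρ.HasOrbitDeriv 1 0 := by
  simpa [HasOrbitDeriv] using hasDerivAt_const (0 : ℝ) (1 : A)

theorem HasOrbitDeriv.mul {x y d e : A} (hx : ρ.HasOrbitDeriv x d) (hy : ρ.HasOrbitDeriv y e) :
    ρ.HasOrbitDeriv (x * y) (d * y + x * e) := by
  have h := HasDerivAt.mul hx hy
  rw [ρ.aut_zero, ρ.aut_zero] at h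
  refine h.congr_of_eventuallyEq (Eventually.of_forall fun t => ?_)
  simp

theorem HasOrbitDeriv.star {x d : A} (hx : ρ.HasOrbitDeriv x d) :
    ρ.HasOrbitDeriv (star x) (star d) := by
  have h := HasDerivAt.star hx
  simp only [← map_star] at h
  exact h

theorem HasOrbitDeriv.hasDerivAt {x d : A} (hx : ρ.HasOrbitDeriv x d) (t : ℝ) :
    HasDerivAt (fun s => ρ.aut s x) (ρ.aut t d) t := by
  have h1 : HasDerivAt (fun s => ρ.aut s x) d (t - t) := by rwa [sub_self]
  have h2 := h1.comp_sub_const t t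
  have h3 := ((ρ.autL t).restrictScalars ℝ).hasFDerivAt.comp_hasDerivAt t h2
  refine h3.congr_of_eventuallyEq (Eventually.of_forall fun s => ?_)
  show ρ.aut s x = ρ.aut t (ρ.aut (s - t) x)
  rw [← ρ.aut_add, add_sub_cancel]

/-- The generator is closed. -/
theorem hasOrbitDeriv_of_tendsto {x d : ℕ → A} {x₀ d₀ : A} (h : ∀ n, ρ.HasOrbitDeriv (x n) (d n))
    (hx : Tendsto x atTop (𝓝 x₀)) (hd : Tendsto d atTop (𝓝 d₀)) : ρ.HasOrbitDeriv x₀ d₀ := by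
  have key := hasDerivAt_of_tendstoUniformly (l := atTop) (f := fun n t => ρ.aut t (x n))
    (g := fun t => ρ.aut t x₀) (f' := fun n t => ρ.aut t (d n)) (g' := fun t => ρ.aut t d₀)
    ?_ (Eventually.of_forall fun n t => (h n).hasDerivAt t)
    (fun t => ((ρ.autL t).continuous.tendsto x₀).comp hx) 0
  · rwa [ρ.aut_zero] at key
  · rw [Metric.tendstoUniformly_iff]
    intro ε hε
    filter_upwards [Metric.tendsto_nhds.mp hd ε hε] with n hn t
    rw [dist_comm, dist_eq_norm, ← map_sub]
    rw [dist_eq_norm] at hn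
    exact (ρ.norm_aut_le t _).trans_lt hn

/-- The partial products `w (n - 1) * ⋯ * w 0`. -/
def _root_.leftProd {M : Type*} [Monoid M] (w : ℕ → M) : ℕ → M
  | 0 => 1
  | n + 1 => w n * leftProd w n

theorem _root_.leftProd_mem_unitary {w : ℕ → A} (hw : ∀ n, w n ∈ unitary A) (n : ℕ) :
    leftProd w n ∈ unitary A := by
  induction n with
  | zero => exact one_mem _
  | succ n ih => exact mul_mem (hw n) ih

/-- An infinite product of unitaries converges to a differentiable unitary if the deviations of the
factors from `1` and their derivatives are summable. -/
theorem exists_tendsto_leftProd {w d : ℕ → A} (hw : ∀ n, w n ∈ unitary A)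
    (hd : ∀ n, ρ.HasOrbitDeriv (w n) (d n)) (h1 : Summable fun n => ‖w n - 1‖)
    (h2 : Summable fun n => ‖d n‖) :
    ∃ u ∈ unitary A, Tendsto (leftProd w) atTop (𝓝 u) ∧ ∃ e, ρ.HasOrbitDeriv u e := by
  have hU := leftProd_mem_unitary hw
  have hc : CauchySeq (leftProd w) := by
    refine cauchySeq_of_summable_dist (Summable.of_nonneg_of_le (fun _ => dist_nonneg)
      (fun n => ?_) h1)
    rw [dist_comm, dist_eq_norm]
    have : leftProd w n.succ - leftProd w n = (w n - 1) * leftProd w n := by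
      rw [sub_mul, one_mul]; rfl
    rw [this]
    exact (norm_mul_le _ _).trans (mul_le_of_le_one_right (norm_nonneg _)
      (norm_le_one_of_mem_unitary (hU n)))
  obtain ⟨u, hu⟩ := cauchySeq_tendsto_of_complete hc
  let D : ℕ → A := fun n => Nat.rec 0 (fun n x => d n * leftProd w n + w n * x) n
  have hDs : ∀ n, D (n + 1) = d n * leftProd w n + w n * D n := fun n => rfl
  have hD : ∀ n, ρ.HasOrbitDeriv (leftProd w n) (D n) := by
    intro n
    induction n with
    | zero => exact hasOrbitDeriv_one
    | succ n ih => exact (hd n).mul ih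
  have hb : ∀ n, ‖d n * leftProd w n‖ ≤ ‖d n‖ := fun n =>
    (norm_mul_le _ _).trans (mul_le_of_le_one_right (norm_nonneg _)
      (norm_le_one_of_mem_unitary (hU n)))
  have hDb : ∀ n, ‖D n‖ ≤ ∑ i ∈ Finset.range n, ‖d i‖ := by
    intro n
    induction n with
    | zero => simp [D]
    | succ n ih =>
      rw [hDs, Finset.sum_range_succ, add_comm]
      refine (norm_add_le _ _).trans (add_le_add ?_ (hb n))
      exact (norm_mul_le _ _).trans ((mul_le_of_le_one_left (norm_nonneg _)
        (norm_le_one_of_mem_unitary (hw n))).trans ih)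
  have hDc : CauchySeq D := by
    refine cauchySeq_of_summable_dist (Summable.of_nonneg_of_le (fun _ => dist_nonneg)
      (fun n => ?_) (h2.add (h1.mul_right (∑' i, ‖d i‖))))
    rw [dist_comm, dist_eq_norm]
    have : D n.succ - D n = d n * leftProd w n + (w n - 1) * D n := by
      rw [sub_mul, one_mul, Nat.succ_eq_add_one, hDs]; abel
    rw [this]
    refine (norm_add_le _ _).trans (add_le_add (hb n) ((norm_mul_le _ _).trans ?_))
    gcongr
    exact (hDb n).trans (h2.sum_le_tsum _ fun _ _ => norm_nonneg _)
  obtain ⟨e, he⟩ := cauchySeq_tendsto_of_complete hDc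
  refine ⟨u, ?_, hu, e, hasOrbitDeriv_of_tendsto hD hu he⟩
  have h3 : IsClosed (unitary A : Set A) := by
    have : (unitary A : Set A) = {x | star x * x = 1} ∩ {x | x * star x = 1} := rfl
    rw [this]
    exact (isClosed_eq (by fun_prop) continuous_const).inter
      (isClosed_eq (by fun_prop) continuous_const)
  exact h3.mem_of_tendsto hu (Eventually.of_forall hU)

end AutFlow

end Flow

/-! ### Intertwiners of quasi-free states -/

section Intertwiner

variable {H : Type u} [NormedAddCommGroup H] [InnerProductSpace ℂ H]

/-- `u` is a differentiable unitary that intertwines `ω₁` and `ω₂` and lowers the charge of `ω₁`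
by `k`. -/
structure IsIntertwiner (u : CAR H) (ω₁ ω₂ : CAR H →L[ℂ] ℂ) (k : ℤ) : Prop where
  mem_unitary : u ∈ unitary (CAR H)
  exists_deriv : ∃ d, (CAR.charge H).HasOrbitDeriv u d
  apply_eq : ∀ x, ω₂ x = ω₁ (star u * x * u)
  charge_eq : ∀ t : ℝ, ω₁ (star u * (CAR.charge H).aut t u) = Complex.exp (-(Complex.I * k * t))

variable {P₁ P₂ : H →L[ℂ] H} {ω₁ ω₂ ω₃ : CAR H →L[ℂ] ℂ}

theorem IsQuasiFree.isIntertwiner_one (h : IsQuasiFree P₁ ω₁) : IsIntertwiner 1 ω₁ ω₁ 0 where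
  mem_unitary := one_mem _
  exists_deriv := ⟨0, AutFlow.hasOrbitDeriv_one⟩
  apply_eq x := by simp
  charge_eq t := by simp [h.apply_one]

theorem conj_star_mul {u u' : CAR H} (hu : u ∈ unitary (CAR H))
    (h : ∀ x, ω₂ x = ω₁ (star u * x * u)) (h' : ∀ x, ω₂ x = ω₁ (star u' * x * u')) (y : CAR H) :
    ω₁ (star (star u * u') * y * (star u * u')) = ω₁ y := by
  have e1 : star (star u * u') * y * (star u * u') = star u' * (u * y * star u) * u' := by
    simp only [star_mul, star_star, mul_assoc]
  have e2 : star u * (u * y * star u) * u = (star u * u) * y * (star u * u) := by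
    simp only [mul_assoc]
  rw [e1, ← h', h, e2, Unitary.star_mul_self_of_mem hu, one_mul, mul_one]

theorem apply_aut_conj (hi₁ : (CAR.charge H).Invariant ω₁) (hi₂ : (CAR.charge H).Invariant ω₂)
    {u : CAR H} (h : ∀ x, ω₂ x = ω₁ (star u * x * u)) (t : ℝ) (x : CAR H) :
    ω₂ x = ω₁ (star ((CAR.charge H).aut t u) * x * (CAR.charge H).aut t u) := by
  have e : star ((CAR.charge H).aut t u) * x * (CAR.charge H).aut t u =
      (CAR.charge H).aut t (star u * (CAR.charge H).aut (-t) x * u) := by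
    rw [map_mul, map_mul, map_star, AutFlow.aut_neg_aut]
  rw [e, hi₁, ← h, hi₂]

theorem mul_star_mul_of_mem_unitary {u : CAR H} (hu : u ∈ unitary (CAR H)) (x : CAR H) :
    u * (star u * x) = x := by
  rw [← mul_assoc, Unitary.mul_star_self_of_mem hu, one_mul]

variable [CompleteSpace H]

/-- The phase `ω₁(u* ρ_t(u))` does not depend on the choice of the intertwiner `u`. -/
theorem apply_star_mul_aut_eq (hP₁ : IsStarProjection P₁) (hP₂ : IsStarProjection P₂)
    (h₁ : IsQuasiFree P₁ ω₁) (h₂ : IsQuasiFree P₂ ω₂) {u u' : CAR H} (hu : u ∈ unitary (CAR H))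
    (h : ∀ x, ω₂ x = ω₁ (star u * x * u))
    (h' : ∀ x, ω₂ x = ω₁ (star u' * x * u')) (t : ℝ) :
    ω₁ (star u' * (CAR.charge H).aut t u') = ω₁ (star u * (CAR.charge H).aut t u) := by
  have hi₁ := h₁.invariant hP₁
  have hi₂ := h₂.invariant hP₂
  set v := star u * u' with hv
  have huv : u' = u * v := (mul_star_mul_of_mem_unitary hu u').symm
  have hvs : ∀ y, ω₁ (star v * y * v) = ω₁ y := conj_star_mul hu h h'
  have hvt : ∀ y, ω₁ (star ((CAR.charge H).aut t v) * y * (CAR.charge H).aut t v) = ω₁ y :=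
    fun y => (apply_aut_conj hi₁ hi₁ (fun x => (hvs x).symm) t y).symm
  have e1 : star u' * (CAR.charge H).aut t u' =
      star v * ((star u * (CAR.charge H).aut t u) * (CAR.charge H).aut t v) := by
    rw [huv, star_mul, map_mul]
    simp only [mul_assoc]
  have e2 : ω₁ (star v) * ω₁ v = 1 := by
    have := hvs 1
    rw [mul_one, h₁.apply_one] at this
    rw [← (h₁.apply_mul_eq hP₁ hvs v).2, this]
  rw [e1, (h₁.apply_mul_eq hP₁ hvs _).2, (h₁.apply_mul_eq hP₁ hvt _).1, hi₁, ← mul_assoc, e2,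
    one_mul]

namespace IsIntertwiner

theorem trans (hP₁ : IsStarProjection P₁) (hP₂ : IsStarProjection P₂)
    (h₁ : IsQuasiFree P₁ ω₁) (h₂ : IsQuasiFree P₂ ω₂) {u w : CAR H} {k l : ℤ}
    (hu : IsIntertwiner u ω₁ ω₂ k) (hw : IsIntertwiner w ω₂ ω₃ l) :
    IsIntertwiner (w * u) ω₁ ω₃ (k + l) where
  mem_unitary := mul_mem hw.mem_unitary hu.mem_unitary
  exists_deriv := by
    obtain ⟨d, hd⟩ := hu.exists_deriv
    obtain ⟨e, he⟩ := hw.exists_deriv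
    exact ⟨_, he.mul hd⟩
  apply_eq x := by
    rw [hw.apply_eq, hu.apply_eq, star_mul]
    simp only [mul_assoc]
  charge_eq t := by
    set v := star u * (CAR.charge H).aut t u with hv
    have huv : (CAR.charge H).aut t u = u * v :=
      (mul_star_mul_of_mem_unitary hu.mem_unitary _).symm
    have hvs : ∀ y, ω₁ (star v * y * v) = ω₁ y :=
      conj_star_mul hu.mem_unitary hu.apply_eq
        (apply_aut_conj (h₁.invariant hP₁) (h₂.invariant hP₂) hu.apply_eq t)
    have e1 : star (w * u) * (CAR.charge H).aut t (w * u) =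
        star u * (star w * (CAR.charge H).aut t w) * u * v := by
      rw [star_mul, map_mul, huv]
      simp only [mul_assoc]
    rw [e1, (h₁.apply_mul_eq hP₁ hvs _).1, ← hu.apply_eq, hw.charge_eq, hv, hu.charge_eq,
      ← Complex.exp_add]
    congr 1
    push_cast
    ring

theorem symm (hP₁ : IsStarProjection P₁) (h₁ : IsQuasiFree P₁ ω₁) {u : CAR H} {k : ℤ}
    (hu : IsIntertwiner u ω₁ ω₂ k) : IsIntertwiner (star u) ω₂ ω₁ (-k) where
  mem_unitary := Unitary.star_mem hu.mem_unitary
  exists_deriv := by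
    obtain ⟨d, hd⟩ := hu.exists_deriv
    exact ⟨_, hd.star⟩
  apply_eq x := by
    rw [hu.apply_eq]
    have : star u * (star (star u) * x * star u) * u = (star u * u) * x * (star u * u) := by
      simp only [mul_assoc, star_star]
    rw [this, Unitary.star_mul_self_of_mem hu.mem_unitary, one_mul, mul_one]
  charge_eq t := by
    have e : star u * (star (star u) * (CAR.charge H).aut t (star u)) * u =
        (CAR.charge H).aut t (star u * (CAR.charge H).aut (-t) u) := by
      rw [map_mul, AutFlow.aut_neg_aut, star_star, ← mul_assoc,
        Unitary.star_mul_self_of_mem hu.mem_unitary, one_mul]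
    rw [hu.apply_eq, e, h₁.invariant hP₁, hu.charge_eq]
    congr 1
    push_cast
    ring

end IsIntertwiner

end Intertwiner

/-! ### Field operators -/

namespace CAR

variable {H : Type u} [NormedAddCommGroup H] [InnerProductSpace ℂ H]

/-- The field operator `a(f) + a(f)*`. -/
def field (f : H) : CAR H := a f + star (a f)

theorem star_field (f : H) : star (field f) = field f := by
  rw [field, star_add, star_star, add_comm]

theorem field_sub (f g : H) : field (f - g) = field f - field g := by
  simp only [field, a_sub, star_sub]
  abel

theorem norm_a_le (f : H) : ‖a f‖ ≤ ‖f‖ := by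
  have hsq : a f * a f = 0 := by
    have h := anticomm f f
    rw [← two_smul ℂ] at h
    exact (smul_eq_zero.mp h).resolve_left two_ne_zero
  have h := CStarAlgebra.norm_sq_le_of_anticomm hsq (anticomm_star f f)
  rw [inner_self_eq_norm_sq_to_K] at h
  simp only [Complex.coe_algebraMap, norm_pow, Complex.norm_real, norm_norm] at h
  exact le_of_sq_le_sq h (norm_nonneg f)

theorem norm_field_le (f : H) : ‖field f‖ ≤ 2 * ‖f‖ := by
  refine (norm_add_le _ _).trans ?_
  rw [norm_star]
  linarith [norm_a_le f]

theorem field_mul_field (f g : H) :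
    field f * field g + field g * field f = (⟪f, g⟫_ℂ + ⟪g, f⟫_ℂ) • 1 := by
  have h1 := anticomm f g
  have h2 := anticomm_star f g
  have h3 := anticomm_star g f
  have h4 : star (a f) * star (a g) + star (a g) * star (a f) = 0 := by
    rw [star_a_mul_star_a, neg_add_cancel]
  rw [add_smul, ← h2, ← h3]
  have e : field f * field g + field g * field f = (a f * a g + a g * a f)
      + (a f * star (a g) + star (a g) * a f) + (a g * star (a f) + star (a f) * a g)
      + (star (a f) * star (a g) + star (a g) * star (a f)) := by
    simp only [field]
    noncomm_ring
  rw [e, h1, h4]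
  abel

theorem field_mul_self {e : H} (he : ‖e‖ = 1) : field e * field e = 1 := by
  have h := field_mul_field e e
  rw [inner_self_eq_norm_sq_to_K, he] at h
  have h2 : (2 : ℂ) • (field e * field e) = (2 : ℂ) • 1 := by
    rw [two_smul, h]
    norm_num
  exact smul_right_injective _ (two_ne_zero : (2 : ℂ) ≠ 0) h2

theorem field_mem_unitary {e : H} (he : ‖e‖ = 1) : field e ∈ unitary (CAR H) := by
  rw [Unitary.mem_iff, star_field, field_mul_self he]
  exact ⟨rfl, rfl⟩

theorem charge_field (t : ℝ) (f : H) : (charge H).aut t (field f) =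
    Complex.exp (-(Complex.I * t)) • a f + Complex.exp (Complex.I * t) • star (a f) := by
  rw [field, map_add, charge_a, charge_star_a]

theorem hasOrbitDeriv_field (f : H) :
    (charge H).HasOrbitDeriv (field f) (field (Complex.I • f)) := by
  have h1 : HasDerivAt (fun t : ℝ => Complex.exp (Complex.I * t)) Complex.I 0 := by
    have := ((Complex.ofRealCLM.hasDerivAt (x := (0 : ℝ))).const_mul Complex.I).cexp
    simpa using this
  have h2 : HasDerivAt (fun t : ℝ => Complex.exp (-(Complex.I * t))) (-Complex.I) 0 := by
    have := ((Complex.ofRealCLM.hasDerivAt (x := (0 : ℝ))).const_mul Complex.I).neg.cexp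
    simpa using this
  have h3 := (h2.smul_const (a f)).add (h1.smul_const (star (a f)))
  have e : field (Complex.I • f) = -Complex.I • a f + Complex.I • star (a f) := by
    rw [field, a_smul, star_smul]
    simp
  rw [AutFlow.HasOrbitDeriv, e]
  refine h3.congr_of_eventuallyEq (Eventually.of_forall fun t => ?_)
  exact charge_field t f

theorem field_mul_a (e g : H) : field e * a g = ⟪g, e⟫_ℂ • 1 - a g * field e := by
  rw [← anticomm_star, field, add_mul, mul_add, a_mul_a e g]
  abel

theorem star_a_mul_field (e f : H) :
    star (a f) * field e = ⟪e, f⟫_ℂ • 1 - field e * star (a f) := by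
  have := congrArg star (field_mul_a e f)
  rwa [star_mul, star_field, star_sub, star_smul, star_one, star_mul, star_field,
    Complex.star_def, inner_conj_symm] at this

theorem field_conj_star_a_mul_a {e : H} (he : ‖e‖ = 1) (f g : H) :
    field e * (star (a f) * a g) * field e = (⟪e, f⟫_ℂ * ⟪g, e⟫_ℂ) • 1
      - ⟪e, f⟫_ℂ • (field e * a g) - ⟪g, e⟫_ℂ • (star (a f) * field e) + star (a f) * a g := by
  have h1 : a g * field e = ⟪g, e⟫_ℂ • 1 - field e * a g := by rw [field_mul_a]; abel
  have h2 : field e * star (a f) = ⟪e, f⟫_ℂ • 1 - star (a f) * field e := by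
    rw [star_a_mul_field]; abel
  have e1 : field e * (star (a f) * a g) * field e =
      (field e * star (a f)) * (a g * field e) := by simp only [mul_assoc]
  have e2 : star (a f) * field e * (field e * a g) = star (a f) * a g := by
    rw [mul_assoc, ← mul_assoc (field e), field_mul_self he, one_mul]
  rw [e1, h1, h2, sub_mul, mul_sub, mul_sub, e2]
  simp only [smul_mul_assoc, mul_smul_comm, one_mul, mul_one, smul_smul]
  rw [mul_comm ⟪g, e⟫_ℂ]
  abel

end CAR

end

noncomputable section

/-! ### Filling and emptying one-particle states -/

open InnerProductSpace (rankOne)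

section Toggle

variable {H : Type u} [NormedAddCommGroup H] [InnerProductSpace ℂ H] [CompleteSpace H]
  {Q Q' : H →L[ℂ] H} {ω : CAR H →L[ℂ] ℂ} {e : H}

theorem IsStarProjection.sub_rankOne (hQ : IsStarProjection Q) (he : ‖e‖ = 1) (h : Q e = e) :
    IsStarProjection (Q - rankOne ℂ e e) := by
  refine (InnerProductSpace.isStarProjection_rankOne_self he).sub_of_mul_eq_right hQ ?_
  ext x
  simp [h]

theorem IsStarProjection.add_rankOne (hQ : IsStarProjection Q) (he : ‖e‖ = 1) (h : Q e = 0) :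
    IsStarProjection (Q + rankOne ℂ e e) := by
  refine hQ.add (InnerProductSpace.isStarProjection_rankOne_self he) ?_
  ext x
  simp [h]

namespace IsQuasiFree

theorem conj_field (h : IsQuasiFree Q ω) (hQ : IsStarProjection Q) (hQ' : IsStarProjection Q')
    (he : ‖e‖ = 1) (hform : ∀ f, ⟪f, Q' f⟫_ℂ =
      ⟪e, f⟫_ℂ * ⟪f, e⟫_ℂ - ⟪e, f⟫_ℂ * ⟪f, Q e⟫_ℂ - ⟪f, e⟫_ℂ * ⟪e, Q f⟫_ℂ + ⟪f, Q f⟫_ℂ) :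
    IsQuasiFree Q' (conjFunctional ω (CAR.field e)) := by
  refine of_twoPoint hQ'
    (conjFunctional_mem_stateSpace (h.mem_stateSpace hQ) (CAR.field_mem_unitary he)) fun f => ?_
  have h1 : ω (CAR.field e * CAR.a f) = ⟪f, Q e⟫_ℂ := by
    rw [CAR.field, add_mul, map_add, h.apply_a_mul_a, h.apply_star_a_mul_a, zero_add]
  have h2 : ω (star (CAR.a f) * CAR.field e) = ⟪e, Q f⟫_ℂ := by
    rw [CAR.field, mul_add, map_add, h.apply_star_a_mul_star_a, h.apply_star_a_mul_a, add_zero]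
  rw [conjFunctional_apply, CAR.star_field, CAR.field_conj_star_a_mul_a he, hform]
  simp only [map_add, map_sub, map_smul, h1, h2, h.apply_one, h.apply_star_a_mul_a, smul_eq_mul,
    mul_one]

theorem conj_field_of_apply_eq (h : IsQuasiFree Q ω) (hQ : IsStarProjection Q) (he : ‖e‖ = 1)
    (hQe : Q e = e) : IsQuasiFree (Q - rankOne ℂ e e) (conjFunctional ω (CAR.field e)) := by
  refine h.conj_field hQ (hQ.sub_rankOne he hQe) he fun f => ?_
  rw [hQe, ← hQ.inner_apply_left e, hQe]
  simp
  ring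

theorem conj_field_of_apply_eq_zero (h : IsQuasiFree Q ω) (hQ : IsStarProjection Q) (he : ‖e‖ = 1)
    (hQe : Q e = 0) : IsQuasiFree (Q + rankOne ℂ e e) (conjFunctional ω (CAR.field e)) := by
  refine h.conj_field hQ (hQ.add_rankOne he hQe) he fun f => ?_
  rw [hQe, ← hQ.inner_apply_left e, hQe]
  simp
  ring

omit [CompleteSpace H] in
theorem apply_field_mul_charge_field (h : IsQuasiFree Q ω) (t : ℝ) :
    ω (CAR.field e * (CAR.charge H).aut t (CAR.field e)) =
      Complex.exp (Complex.I * t) * (⟪e, e⟫_ℂ - ⟪e, Q e⟫_ℂ) +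
        Complex.exp (-(Complex.I * t)) * ⟪e, Q e⟫_ℂ := by
  rw [CAR.charge_field, CAR.field, add_mul, mul_add, mul_add]
  simp only [mul_smul_comm, map_add, map_smul, h.apply_a_mul_a, h.apply_star_a_mul_star_a,
    h.apply_a_mul_star_a, h.apply_star_a_mul_a, smul_eq_mul]
  ring

omit [CompleteSpace H] in
theorem _root_.isIntertwiner_field (he : ‖e‖ = 1) {k : ℤ}
    (hk : ∀ t : ℝ, ω (CAR.field e * (CAR.charge H).aut t (CAR.field e)) =
      Complex.exp (-(Complex.I * k * t))) :
    IsIntertwiner (CAR.field e) ω (conjFunctional ω (CAR.field e)) k where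
  mem_unitary := CAR.field_mem_unitary he
  exists_deriv := ⟨_, CAR.hasOrbitDeriv_field e⟩
  apply_eq := conjFunctional_apply _ _
  charge_eq t := by rw [CAR.star_field, hk]

omit [CompleteSpace H] in
theorem isIntertwiner_field_of_apply_eq (h : IsQuasiFree Q ω) (he : ‖e‖ = 1) (hQe : Q e = e) :
    IsIntertwiner (CAR.field e) ω (conjFunctional ω (CAR.field e)) 1 :=
  _root_.isIntertwiner_field he fun t => by
    rw [h.apply_field_mul_charge_field, hQe, inner_self_eq_norm_sq_to_K, he]
    simp

omit [CompleteSpace H] in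
theorem isIntertwiner_field_of_apply_eq_zero (h : IsQuasiFree Q ω) (he : ‖e‖ = 1)
    (hQe : Q e = 0) : IsIntertwiner (CAR.field e) ω (conjFunctional ω (CAR.field e)) (-1) :=
  _root_.isIntertwiner_field he fun t => by
    rw [h.apply_field_mul_charge_field, hQe, inner_self_eq_norm_sq_to_K, he]
    simp

/-- Emptying finitely many orthonormal one-particle states. -/
theorem exists_isIntertwiner_sub_sum {ι : Type*} {v : ι → H} (hv : Orthonormal ℂ v)
    (hQ : IsStarProjection Q) (hQv : ∀ i, Q (v i) = v i) (h : IsQuasiFree Q ω) (s : Finset ι) :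
    IsStarProjection (Q - ∑ i ∈ s, rankOne ℂ (v i) (v i)) ∧
      ∃ u ω', IsQuasiFree (Q - ∑ i ∈ s, rankOne ℂ (v i) (v i)) ω' ∧
        IsIntertwiner u ω ω' s.card := by
  classical
  induction s using Finset.induction_on with
  | empty => simpa using ⟨hQ, 1, ω, h, h.isIntertwiner_one⟩
  | insert i s hi ih =>
    obtain ⟨hs, u, ω', h', hu⟩ := ih
    have hi' : (Q - ∑ j ∈ s, rankOne ℂ (v j) (v j)) (v i) = v i := by
      rw [sub_apply, hQv, sum_apply, Finset.sum_eq_zero, sub_zero]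
      intro j hj
      have : j ≠ i := fun h => hi (h ▸ hj)
      rw [InnerProductSpace.rankOne_apply, hv.2 this, zero_smul]
    rw [Finset.sum_insert hi, add_comm, ← sub_sub]
    refine ⟨hs.sub_rankOne (hv.1 i) hi', CAR.field (v i) * u, _, h'.conj_field_of_apply_eq hs (hv.1 i) hi', ?_⟩
    have := hu.trans hQ hs h h' (h'.isIntertwiner_field_of_apply_eq (hv.1 i) hi')
    rw [Finset.card_insert_of_notMem hi]
    exact_mod_cast this

end IsQuasiFree

/-- Moving a particle from `p` to `q`. -/
theorem IsQuasiFree.isIntertwiner_field_mul_field {p q : H} (h : IsQuasiFree Q ω)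
    (hQ : IsStarProjection Q) (hp : ‖p‖ = 1) (hq : ‖q‖ = 1) (hQp : Q p = p)
    (hQq : Q q = ⟪p, q⟫_ℂ • p) {ω' : CAR H →L[ℂ] ℂ}
    (hω' : ω' = conjFunctional ω (CAR.field q * CAR.field p)) :
    IsStarProjection (Q + (rankOne ℂ q q - rankOne ℂ p p)) ∧
      IsQuasiFree (Q + (rankOne ℂ q q - rankOne ℂ p p)) ω' ∧
      IsIntertwiner (CAR.field q * CAR.field p) ω ω' 0 := by
  have e1 : Q + (rankOne ℂ q q - rankOne ℂ p p) = Q - rankOne ℂ p p + rankOne ℂ q q := by abel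
  have e2 : ω' = conjFunctional (conjFunctional ω (CAR.field p)) (CAR.field q) := by
    ext x
    simp only [hω', conjFunctional_apply, star_mul, mul_assoc]
  have h1 := hQ.sub_rankOne hp hQp
  have h2 := h.conj_field_of_apply_eq hQ hp hQp
  have h3 : (Q - rankOne ℂ p p) q = 0 := by
    rw [sub_apply, hQq, InnerProductSpace.rankOne_apply, sub_self]
  rw [e1]
  refine ⟨h1.add_rankOne hq h3, ?_, ?_⟩
  · rw [e2]
    exact h2.conj_field_of_apply_eq_zero h1 hq h3
  · have := (h.isIntertwiner_field_of_apply_eq hp hQp).trans hQ h1 h h2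
      (h2.isIntertwiner_field_of_apply_eq_zero hq h3)
    rw [e2]
    simpa using this

omit [CompleteSpace H] in
theorem CAR.norm_field_mul_field_sub_one_le {p q : H} (hp : ‖p‖ = 1) :
    ‖CAR.field q * CAR.field p - 1‖ ≤ 2 * ‖p - q‖ := by
  have : CAR.field q * CAR.field p - 1 = CAR.field (q - p) * CAR.field p := by
    rw [CAR.field_sub, sub_mul, CAR.field_mul_self hp]
  rw [this, norm_sub_rev]
  exact (norm_mul_le _ _).trans ((mul_le_of_le_one_right (norm_nonneg _)
    (norm_le_one_of_mem_unitary (CAR.field_mem_unitary hp))).trans (CAR.norm_field_le _))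

omit [CompleteSpace H] in
theorem CAR.norm_deriv_field_mul_field_le {p q : H} (hp : ‖p‖ = 1) :
    ‖CAR.field (Complex.I • q) * CAR.field p + CAR.field q * CAR.field (Complex.I • p)‖ ≤
      4 * ‖p - q‖ := by
  have h0 := CAR.field_mul_field (Complex.I • p) p
  have h1 : ⟪Complex.I • p, p⟫_ℂ + ⟪p, Complex.I • p⟫_ℂ = 0 := by
    rw [inner_smul_left, inner_smul_right, Complex.conj_I]
    ring
  rw [h1, zero_smul] at h0
  have hI : ‖Complex.I • p‖ = 1 := by rw [norm_smul, hp]; simp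
  have : CAR.field (Complex.I • q) * CAR.field p + CAR.field q * CAR.field (Complex.I • p) =
      CAR.field (Complex.I • (q - p)) * CAR.field p +
        CAR.field (q - p) * CAR.field (Complex.I • p) := by
    rw [smul_sub, CAR.field_sub, CAR.field_sub, sub_mul, sub_mul]
    have h2 := eq_neg_of_add_eq_zero_left h0
    rw [h2]
    abel
  have hb : ∀ x y : H, ‖y‖ = 1 → ‖CAR.field x * CAR.field y‖ ≤ 2 * ‖x‖ := fun x y hy =>
    (norm_mul_le _ _).trans ((mul_le_of_le_one_right (norm_nonneg _)
      (norm_le_one_of_mem_unitary (CAR.field_mem_unitary hy))).trans (CAR.norm_field_le _))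
  rw [this, norm_sub_rev]
  refine (norm_add_le _ _).trans ((add_le_add (hb _ _ hp) (hb _ _ hI)).trans (le_of_eq ?_))
  rw [norm_smul, Complex.norm_I]
  ring

/-- If the ranges of two projections have orthonormal bases that are pairwise close and otherwise
orthogonal, then their quasi-free states are intertwined by an infinite product of field
operators. -/
theorem exists_isIntertwiner_of_orthonormal {ι : Type*} {p q : ι → H} (hp : Orthonormal ℂ p)
    (hq : Orthonormal ℂ q) (hpq : ∀ k l, k ≠ l → ⟪p k, q l⟫_ℂ = 0)
    (hsum : Summable fun k => ‖p k - q k‖) (hQ : IsStarProjection Q) (hQ' : IsStarProjection Q')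
    (hsp : ∀ x, HasSum (fun k => ⟪p k, x⟫_ℂ • p k) (Q x))
    (hsq : ∀ x, HasSum (fun k => ⟪q k, x⟫_ℂ • q k) (Q' x)) {ω' : CAR H →L[ℂ] ℂ}
    (h : IsQuasiFree Q ω) (h' : IsQuasiFree Q' ω') : ∃ u, IsIntertwiner u ω ω' 0 := by
  classical
  have hQp : ∀ k, Q (p k) = p k := fun k => by
    refine (hsp (p k)).unique ?_
    have := hasSum_single (f := fun l => ⟪p l, p k⟫_ℂ • p l) k fun l hl => by
      rw [hp.2 hl, zero_smul]
    rwa [inner_self_eq_norm_sq_to_K, hp.1, RCLike.ofReal_one, one_pow, one_smul] at this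
  have hQq : ∀ k, Q (q k) = ⟪p k, q k⟫_ℂ • p k := fun k =>
    (hsp (q k)).unique <| hasSum_single (f := fun l => ⟪p l, q k⟫_ℂ • p l) k fun l hl => by
      rw [hpq l k hl, zero_smul]
  let S := Function.support fun k => ‖p k - q k‖
  let : Encodable S := hsum.countable_support.toEncodable
  let enc : S → ℕ := Encodable.encode
  have henc : Function.Injective enc := Encodable.encode_injective
  let w : ℕ → CAR H := Function.extend enc (fun k => CAR.field (q k) * CAR.field (p k)) 1
  let d : ℕ → CAR H := Function.extend enc (fun k => CAR.field (Complex.I • q k) *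
    CAR.field (p k) + CAR.field (q k) * CAR.field (Complex.I • p k)) 0
  let r : ℕ → ℝ := Function.extend enc (fun k => ‖p k - q k‖) 0
  let R : ℕ → H →L[ℂ] H := Function.extend enc
    (fun k => rankOne ℂ (q k) (q k) - rankOne ℂ (p k) (p k)) 0
  have hr : Summable r := (hasSum_extend_zero henc).mpr (hsum.subtype S).hasSum |>.summable
  have hw : ∀ n, w n ∈ unitary (CAR H) ∧ (CAR.charge H).HasOrbitDeriv (w n) (d n) ∧
      ‖w n - 1‖ ≤ 2 * r n ∧ ‖d n‖ ≤ 4 * r n := by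
    intro n
    by_cases hn : ∃ k, enc k = n
    · obtain ⟨k, rfl⟩ := hn
      simp only [w, d, r, henc.extend_apply]
      exact ⟨mul_mem (CAR.field_mem_unitary (hq.1 _)) (CAR.field_mem_unitary (hp.1 _)),
        (CAR.hasOrbitDeriv_field _).mul (CAR.hasOrbitDeriv_field _),
        CAR.norm_field_mul_field_sub_one_le (hp.1 _), CAR.norm_deriv_field_mul_field_le (hp.1 _)⟩
    · simp only [w, d, r, Function.extend_apply' _ _ _ hn, Pi.one_apply, Pi.zero_apply]
      exact ⟨one_mem _, AutFlow.hasOrbitDeriv_one, by simp, by simp⟩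
  obtain ⟨u, hu, hlim, hder⟩ := AutFlow.exists_tendsto_leftProd (ρ := CAR.charge H)
    (fun n => (hw n).1) (fun n => (hw n).2.1)
    (Summable.of_nonneg_of_le (fun _ => norm_nonneg _) (fun n => (hw n).2.2.1) (hr.mul_left 2))
    (Summable.of_nonneg_of_le (fun _ => norm_nonneg _) (fun n => (hw n).2.2.2) (hr.mul_left 4))
  have hR : ∀ (k : S) (i : ℕ), i ≠ enc k → R i (p k) = 0 ∧ R i (q k) = 0 := by
    intro k i hi
    by_cases hn : ∃ l, enc l = i
    · obtain ⟨l, rfl⟩ := hn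
      have hl : (l : ι) ≠ k := fun h => hi (by rw [Subtype.ext h])
      have hqp : ⟪q l, p k⟫_ℂ = 0 := inner_eq_zero_symm.mp (hpq _ _ hl.symm)
      simp only [R, henc.extend_apply]
      simp [hp.2 hl, hq.2 hl, hpq _ _ hl, hqp]
    · simp only [R, Function.extend_apply' _ _ _ hn, Pi.zero_apply]
      exact ⟨rfl, rfl⟩
  let T : ℕ → H →L[ℂ] H := fun n => Q + ∑ i ∈ Finset.range n, R i
  have hT : ∀ n, IsStarProjection (T n) ∧
      IsQuasiFree (T n) (conjFunctional ω (leftProd w n)) ∧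
      IsIntertwiner (leftProd w n) ω (conjFunctional ω (leftProd w n)) 0 := by
    intro n
    induction n with
    | zero =>
      have e : conjFunctional ω (leftProd w 0) = ω := by
        ext x
        simp [conjFunctional_apply, leftProd]
      simp only [T, Finset.range_zero, Finset.sum_empty, add_zero, e]
      exact ⟨hQ, h, h.isIntertwiner_one⟩
    | succ n ih =>
      obtain ⟨i1, i2, i3⟩ := ih
      have hTs : T (n + 1) = T n + R n := by
        simp only [T, Finset.sum_range_succ, add_assoc]
      by_cases hn : ∃ k, enc k = n
      · obtain ⟨k, rfl⟩ := hn
        have hRk : R (enc k) = rankOne ℂ (q k) (q k) - rankOne ℂ (p k) (p k) :=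
          henc.extend_apply _ _ _
        have hwk : w (enc k) = CAR.field (q k) * CAR.field (p k) := henc.extend_apply _ _ _
        have hT1 : T (enc k) (p k) = p k := by
          simp only [T, add_apply, sum_apply, hQp]
          rw [Finset.sum_eq_zero fun i hi => (hR k i (Finset.mem_range.mp hi).ne).1, add_zero]
        have hT2 : T (enc k) (q k) = ⟪p k, q k⟫_ℂ • p k := by
          simp only [T, add_apply, sum_apply, hQq]
          rw [Finset.sum_eq_zero fun i hi => (hR k i (Finset.mem_range.mp hi).ne).2, add_zero]
        have hω' : conjFunctional ω (leftProd w (enc k + 1)) =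
            conjFunctional (conjFunctional ω (leftProd w (enc k)))
              (CAR.field (q k) * CAR.field (p k)) := by
          ext x
          simp only [conjFunctional_apply, leftProd, hwk, star_mul, mul_assoc]
        obtain ⟨j1, j2, j3⟩ := i2.isIntertwiner_field_mul_field i1 (hp.1 _) (hq.1 _) hT1 hT2 hω'
        rw [hTs, hRk]
        refine ⟨j1, j2, ?_⟩
        have := i3.trans hQ i1 h i2 j3
        rw [leftProd, hwk]
        rw [leftProd, hwk] at this
        simpa using this
      · have hRn : R n = 0 := Function.extend_apply' _ _ _ hn
        have hwn : leftProd w (n + 1) = leftProd w n := by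
          have : w n = 1 := Function.extend_apply' _ _ _ hn
          rw [leftProd, this, one_mul]
        rw [hTs, hRn, add_zero, hwn]
        exact ⟨i1, i2, i3⟩
  have hTlim : ∀ x, Tendsto (fun n => T n x) atTop (𝓝 (Q' x)) := by
    intro x
    have h1 := (hsq x).sub (hsp x)
    have hsupp : (Function.support fun k => ⟪q k, x⟫_ℂ • q k - ⟪p k, x⟫_ℂ • p k) ⊆ S := by
      intro k hk
      simp only [S, Function.mem_support, ne_eq, norm_eq_zero] at hk ⊢
      intro h0
      apply hk
      rw [sub_eq_zero.mp h0, sub_self]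
    have h2 := (hasSum_extend_zero henc).mpr
      ((hasSum_subtype_iff_of_support_subset hsupp).mpr h1)
    have h3 := (h2.tendsto_sum_nat).const_add (Q x)
    rw [add_sub_cancel] at h3
    refine h3.congr fun n => ?_
    simp only [T, add_apply, sum_apply]
    congr 1
    refine Finset.sum_congr rfl fun i _ => ?_
    by_cases hi : ∃ k, enc k = i
    · obtain ⟨k, rfl⟩ := hi
      simp only [R, henc.extend_apply, Function.comp, sub_apply, InnerProductSpace.rankOne_apply]
    · simp only [R, Function.extend_apply' _ _ _ hi, Pi.zero_apply]
      rfl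
  have hconj : ∀ x, Tendsto (fun n => conjFunctional ω (leftProd w n) x) atTop
      (𝓝 (conjFunctional ω u x)) := by
    intro x
    simp only [conjFunctional_apply]
    exact (ω.continuous.tendsto _).comp ((hlim.star.mul_const x).mul hlim)
  have hω' : ω' = conjFunctional ω u := by
    refine h'.unique (IsQuasiFree.of_twoPoint hQ'
      (conjFunctional_mem_stateSpace (h.mem_stateSpace hQ) hu) fun f => ?_)
    refine tendsto_nhds_unique (hconj _) ?_
    simp only [(hT _).2.1.apply_star_a_mul_a]
    exact tendsto_const_nhds.inner (hTlim f)
  refine ⟨u, hu, hder, fun x => by rw [hω', conjFunctional_apply], fun t => ?_⟩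
  have hch : Tendsto (fun n => ω (star (leftProd w n) * (CAR.charge H).aut t (leftProd w n))) atTop
      (𝓝 (ω (star u * (CAR.charge H).aut t u))) :=
    (ω.continuous.tendsto _).comp (hlim.star.mul
      ((((CAR.charge H).autL t).continuous.tendsto u).comp hlim))
  refine tendsto_nhds_unique hch ?_
  simp only [(hT _).2.2.charge_eq]
  exact tendsto_const_nhds

end Toggle

end

noncomputable section

open InnerProductSpace (rankOne)

/-! ### Trace class operators -/

section TraceClass

variable {H : Type u} [NormedAddCommGroup H] [InnerProductSpace ℂ H]

theorem HilbertBasis.hasSum_norm_inner_sq {ι E : Type*} [NormedAddCommGroup E]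
    [InnerProductSpace ℂ E] (e : HilbertBasis ι ℂ E) (x : E) :
    HasSum (fun i => ‖⟪e i, x⟫_ℂ‖ ^ 2) (‖x‖ ^ 2) := by
  have h := e.hasSum_inner_mul_inner x x
  have h2 := Complex.hasSum_re h
  rw [inner_self_eq_norm_sq_to_K] at h2
  have h3 : ((‖x‖ : ℂ) ^ 2).re = ‖x‖ ^ 2 := by norm_cast
  simp only [Complex.coe_algebraMap, h3] at h2
  convert h2 using 2 with i
  rw [← inner_conj_symm x (e i), mul_comm, Complex.mul_conj, Complex.normSq_eq_norm_sq]
  norm_cast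

/-- The Hilbert-Schmidt sum does not increase when passing to another orthonormal family. -/
theorem summable_norm_sq_of_orthonormal {B : H →L[ℂ] H} (hB : B.IsSymmetric) {ι κ : Type*}
    (e : HilbertBasis ι ℂ H) (he : Summable fun i => ‖B (e i)‖ ^ 2) {p : κ → H}
    (hp : Orthonormal ℂ p) : Summable fun k => ‖B (p k)‖ ^ 2 := by
  refine summable_of_sum_le (c := ∑' i, ‖B (e i)‖ ^ 2) (fun k => sq_nonneg _) fun s => ?_
  have hk : ∀ k, HasSum (fun i => ‖⟪p k, B (e i)⟫_ℂ‖ ^ 2) (‖B (p k)‖ ^ 2) := fun k => by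
    refine (e.hasSum_norm_inner_sq (B (p k))).congr_fun ?_
    intro i
    have h1 : ⟪B (p k), e i⟫_ℂ = ⟪p k, B (e i)⟫_ℂ := hB (p k) (e i)
    rw [← h1, norm_inner_symm]
  have h := hasSum_sum fun k (_ : k ∈ s) => hk k
  rw [← h.tsum_eq]
  exact h.summable.tsum_le_tsum (fun i => hp.sum_inner_products_le _) he

/-- A Hilbert-Schmidt operator is compact. -/
theorem isCompactOperator_of_summable_norm_sq [CompleteSpace H] {B : H →L[ℂ] H}
    (hB : B.IsSymmetric) {ι : Type*} (e : HilbertBasis ι ℂ H)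
    (he : Summable fun i => ‖B (e i)‖ ^ 2) : IsCompactOperator B := by
  classical
  let F : Finset ι → H →L[ℂ] H := fun s => ∑ i ∈ s, rankOne ℂ (e i) (B (e i))
  have hF : ∀ s, IsCompactOperator (F s) := by
    intro s
    have h1 : ∀ i ∈ s, rankOne ℂ (e i) (B (e i)) ∈ compactOperator (RingHom.id ℂ) H H := by
      intro i _
      show IsCompactOperator (rankOne ℂ (e i) (B (e i)))
      rw [InnerProductSpace.rankOne_def']
      have h2 : IsCompactOperator (innerSL ℂ (B (e i)) : H →L[ℂ] ℂ) :=
        isCompactOperator_of_locallyCompactSpace_dom _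
      exact h2.clm_comp (ContinuousLinearMap.toSpanSingleton ℂ (e i))
    exact sum_mem h1
  refine isCompactOperator_of_tendsto (l := atTop) (F := F) ?_ (Eventually.of_forall hF)
  rw [Metric.tendsto_nhds]
  intro ε hε
  have hv := summable_iff_vanishing_norm.mp he ((ε / 2) ^ 2) (by positivity)
  obtain ⟨s₀, hs₀⟩ := hv
  filter_upwards [eventually_ge_atTop s₀] with s hs
  rw [dist_comm, dist_eq_norm]
  refine lt_of_le_of_lt (ContinuousLinearMap.opNorm_le_bound _ (half_pos hε).le fun x => ?_)
    (half_lt_self hε)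
  refine le_of_sq_le_sq ?_ (by positivity)
  have hcoef : ∀ i, ‖⟪e i, (B - F s) x⟫_ℂ‖ ^ 2 ≤
      if i ∈ s then 0 else ‖B (e i)‖ ^ 2 * ‖x‖ ^ 2 := by
    intro i
    have h1 : ⟪e i, F s x⟫_ℂ = if i ∈ s then ⟪B (e i), x⟫_ℂ else 0 := by
      simp only [F, sum_apply, InnerProductSpace.rankOne_apply, inner_sum, inner_smul_right,
        orthonormal_iff_ite.mp e.orthonormal, mul_ite, mul_one, mul_zero, Finset.sum_ite_eq]
    have h2 : ⟪e i, B x⟫_ℂ = ⟪B (e i), x⟫_ℂ := (hB (e i) x).symm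
    rw [sub_apply, inner_sub_right, h1, h2]
    split_ifs
    · simp
    · rw [sub_zero, ← mul_pow]
      gcongr
      exact norm_inner_le_norm _ _
  have hsum := e.hasSum_norm_inner_sq ((B - F s) x)
  refine hasSum_le_of_sum_le hsum fun t => ?_
  refine (Finset.sum_le_sum fun i _ => hcoef i).trans ?_
  rw [← Finset.sum_filter_add_sum_filter_not t (· ∈ s),
    Finset.sum_eq_zero (s := t.filter (· ∈ s)) fun i hi => if_pos (Finset.mem_filter.mp hi).2,
    zero_add, Finset.sum_congr rfl fun i hi => if_neg (Finset.mem_filter.mp hi).2,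
    ← Finset.sum_mul, mul_pow]
  gcongr
  refine (le_abs_self _).trans (hs₀ _ ?_).le
  rw [Finset.disjoint_left]
  intro i hi hi'
  exact (Finset.mem_filter.mp hi).2 (hs hi')

theorem IsTraceClass.exists_sqrt [CompleteSpace H] {T : H →L[ℂ] H} (hT : IsTraceClass T) :
    ∃ B : H →L[ℂ] H, B.IsSymmetric ∧ B * B = CFC.abs T ∧ IsCompactOperator B ∧
      ∀ {κ : Type u} {p : κ → H}, Orthonormal ℂ p → Summable fun k => ‖B (p k)‖ ^ 2 := by
  obtain ⟨ι, e, he⟩ := hT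
  have hB : (CFC.sqrt (CFC.abs T)).IsSymmetric :=
    (IsSelfAdjoint.of_nonneg (CFC.sqrt_nonneg _)).isSymmetric
  have hBB : CFC.sqrt (CFC.abs T) * CFC.sqrt (CFC.abs T) = CFC.abs T :=
    CFC.sqrt_mul_sqrt_self _ (CFC.abs_nonneg T)
  have he' : Summable fun i => ‖CFC.sqrt (CFC.abs T) (e i)‖ ^ 2 := by
    refine he.congr fun i => ?_
    have h1 : ⟪e i, CFC.abs T (e i)⟫_ℂ =
        ⟪CFC.sqrt (CFC.abs T) (e i), CFC.sqrt (CFC.abs T) (e i)⟫_ℂ := by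
      conv_lhs => rw [← hBB]
      exact (hB (e i) _).symm
    rw [h1, inner_self_eq_norm_sq_to_K]
    simp
  exact ⟨_, hB, hBB, isCompactOperator_of_summable_norm_sq hB e he', fun hp =>
    summable_norm_sq_of_orthonormal hB e he' hp⟩

theorem IsTraceClass.isCompactOperator_star_mul_self [CompleteSpace H] {T : H →L[ℂ] H}
    (hT : IsTraceClass T) : IsCompactOperator (star T * T) := by
  obtain ⟨B, -, hBB, hB, -⟩ := hT.exists_sqrt
  rw [← CFC.abs_mul_abs, ← hBB]
  exact hB.clm_comp (B * B * B)

/-- An eigenvector of the square of a positive operator is an eigenvector of the operator. -/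
theorem apply_eq_sqrt_smul_of_mul_self [CompleteSpace H] {A : H →L[ℂ] H} (hA : 0 ≤ A) {μ : ℝ}
    (hμ : 0 ≤ μ) {x : H} (hx : A (A x) = (μ : ℂ) • x) : A x = (Real.sqrt μ : ℂ) • x := by
  have hpos := (ContinuousLinearMap.nonneg_iff_isPositive A).mp hA
  have hsym : A.IsSymmetric := (IsSelfAdjoint.of_nonneg hA).isSymmetric
  rcases hμ.eq_or_lt with h0 | h0
  · rw [← h0] at hx ⊢
    have : ⟪A x, A x⟫_ℂ = 0 := by
      have := hsym x (A x)
      simp only [ContinuousLinearMap.coe_coe] at this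
      rw [this, hx]
      simp
    rw [inner_self_eq_zero.mp this]
    simp
  · set y := A x - (Real.sqrt μ : ℂ) • x with hy
    have hss : (Real.sqrt μ : ℂ) * Real.sqrt μ = μ := by
      rw [← Complex.ofReal_mul, Real.mul_self_sqrt hμ]
    have h1 : A y = -((Real.sqrt μ : ℂ) • y) := by
      rw [hy, map_sub, map_smul, hx, smul_sub, smul_smul, hss]
      abel
    have h2 := hpos.inner_nonneg_right y
    rw [h1, inner_neg_right, inner_smul_right, inner_self_eq_norm_sq_to_K] at h2
    have h3 : 0 ≤ -(Real.sqrt μ * ‖y‖ ^ 2) := by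
      have := (Complex.le_def.mp h2).1
      simp only [Complex.coe_algebraMap] at this
      norm_cast at this
    have h4 : ‖y‖ ^ 2 = 0 := by
      have := Real.sqrt_pos.mpr h0
      nlinarith [sq_nonneg ‖y‖]
    have h5 : y = 0 := by simpa using h4
    exact sub_eq_zero.mp h5

end TraceClass

/-! ### Principal vectors of a pair of projections -/

section Principal

variable {H : Type u} [NormedAddCommGroup H] [InnerProductSpace ℂ H] [CompleteSpace H]

theorem IsStarProjection.completeSpace_range {P : H →L[ℂ] H} (hP : IsStarProjection P) :
    CompleteSpace P.range := by
  have : (P.range : Set H) = {x | P x = x} := by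
    ext x
    exact ⟨by rintro ⟨y, rfl⟩; exact hP.apply_apply y, fun h => ⟨x, h⟩⟩
  have hK : IsClosed (P.range : Set H) := by
    rw [this]
    exact isClosed_eq P.continuous continuous_id
  exact hK.completeSpace_coe

theorem IsStarProjection.hasSum_inner_smul {Q : H →L[ℂ] H} (hQ : IsStarProjection Q) {κ : Type*}
    {p : κ → H} (hp : Orthonormal ℂ p) (hQp : ∀ k, Q (p k) = p k)
    (htot : ∀ x, Q x = x → (∀ k, ⟪p k, x⟫_ℂ = 0) → x = 0) (x : H) :
    HasSum (fun k => ⟪p k, x⟫_ℂ • p k) (Q x) := by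
  have := hQ.completeSpace_range
  let v : κ → Q.range := fun k => ⟨p k, p k, hQp k⟩
  have hv : Orthonormal ℂ v := by
    refine ⟨fun k => hp.1 k, fun k l hkl => hp.2 hkl⟩
  have hspan : (Submodule.span ℂ (Set.range v))ᗮ = ⊥ := by
    rw [Submodule.eq_bot_iff]
    intro y hy
    rw [Submodule.mem_orthogonal] at hy
    have hy' : Q y = y := by
      obtain ⟨_, z, rfl⟩ := y
      exact hQ.apply_apply z
    exact Subtype.ext (htot y hy' fun k => hy (v k) (Submodule.subset_span ⟨k, rfl⟩))
  let b := HilbertBasis.mkOfOrthogonalEqBot hv hspan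
  have h := (b.hasSum_repr ⟨Q x, x, rfl⟩).mapL Q.range.subtypeL
  refine h.congr_fun ?_
  intro k
  have hb : b k = v k := by
    rw [HilbertBasis.coe_mkOfOrthogonalEqBot]
  rw [map_smul, b.repr_apply_apply, hb, Submodule.coe_inner]
  simp only [v]
  rw [← hQ.inner_apply_left, hQp]
  rfl

theorem IsStarProjection.sub_sum_rankOne {Q : H →L[ℂ] H} (hQ : IsStarProjection Q) {ι : Type*}
    {v : ι → H} (hv : Orthonormal ℂ v) (hQv : ∀ i, Q (v i) = v i) (s : Finset ι) :
    IsStarProjection (Q - ∑ i ∈ s, rankOne ℂ (v i) (v i)) := by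
  obtain ⟨ω, hω, -⟩ := existsUnique_isQuasiFree hQ
  exact (hω.exists_isIntertwiner_sub_sum hv hQ hQv s).1

theorem apply_eq_self_of_sub_sum_rankOne {Q : H →L[ℂ] H} (hQ : IsStarProjection Q) {n : ℕ}
    {v : Fin n → H} (hv : Orthonormal ℂ v) (hQv : ∀ i, Q (v i) = v i) {x : H}
    (hx : (Q - ∑ i, rankOne ℂ (v i) (v i)) x = x) : Q x = x ∧ ∀ i, ⟪v i, x⟫_ℂ = 0 := by
  simp only [sub_apply, sum_apply, InnerProductSpace.rankOne_apply] at hx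
  have h1 : Q x = x := by
    have := congrArg Q hx
    simp only [map_sub, map_sum, map_smul, hQ.apply_apply, hQv] at this
    rw [← this, hx]
  refine ⟨h1, fun i => ?_⟩
  rw [h1, sub_eq_self] at hx
  have := congrArg (fun y => ⟪v i, y⟫_ℂ) hx
  simpa [inner_sum, inner_smul_right, orthonormal_iff_ite.mp hv] using this

omit [CompleteSpace H] in
theorem inner_eq_zero_of_mem_span {n : ℕ} {v : Fin n → H} {x y : H}
    (hx : ∀ i, ⟪v i, x⟫_ℂ = 0) (hy : y ∈ Submodule.span ℂ (Set.range v)) : ⟪y, x⟫_ℂ = 0 := by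
  induction hy using Submodule.span_induction with
  | mem y hy => obtain ⟨i, rfl⟩ := hy; exact hx i
  | zero => simp
  | add y z _ _ hy hz => rw [inner_add_left, hy, hz, add_zero]
  | smul r y _ hy => rw [inner_smul_left, hy, mul_zero]

variable {P₁ P₂ : H →L[ℂ] H}

theorem star_sub_mul_sub_apply (hP₁ : IsStarProjection P₁) (hP₂ : IsStarProjection P₂) {x : H}
    (hx : P₁ x = x) : (star (P₁ - P₂) * (P₁ - P₂)) x = x - P₁ (P₂ x) := by
  rw [(hP₁.isSelfAdjoint.sub hP₂.isSelfAdjoint).star_eq, mul_apply_eq_comp]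
  simp only [sub_apply, map_sub, hx, hP₂.apply_apply]
  abel

theorem commute_star_sub_mul_sub (hP₁ : IsStarProjection P₁) (hP₂ : IsStarProjection P₂) :
    Commute (star (P₁ - P₂) * (P₁ - P₂)) P₁ := by
  have h1 := hP₁.isIdempotentElem.eq
  have h2 := hP₂.isIdempotentElem.eq
  rw [(hP₁.isSelfAdjoint.sub hP₂.isSelfAdjoint).star_eq, Commute, SemiconjBy]
  have e1 : (P₁ - P₂) * (P₁ - P₂) * P₁ = P₁ * P₁ * P₁ - P₁ * P₂ * P₁ - P₂ * (P₁ * P₁)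
      + P₂ * P₂ * P₁ := by noncomm_ring
  have e2 : P₁ * ((P₁ - P₂) * (P₁ - P₂)) = P₁ * P₁ * P₁ - P₁ * P₁ * P₂ - P₁ * P₂ * P₁
      + P₁ * (P₂ * P₂) := by noncomm_ring
  rw [e1, e2, h1, h2]
  abel

/-- An orthonormal basis of eigenvectors of `P₁ P₂` in the part of the range of `P₁` that is
orthogonal to the kernel of `P₂`. -/
theorem exists_principal_basis (hP₁ : IsStarProjection P₁) (hP₂ : IsStarProjection P₂)
    (hP : IsTraceClass (P₁ - P₂)) :
    ∃ (κ : Type u) (p : κ → H) (μ : κ → ℂ), Orthonormal ℂ p ∧ (∀ k, P₁ (p k) = p k) ∧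
      (∀ k, μ k ≠ 0) ∧ (∀ k, P₁ (P₂ (p k)) = μ k • p k) ∧
      ∀ x, P₁ x = x → (∀ y, P₁ y = y → P₂ y = 0 → ⟪y, x⟫_ℂ = 0) →
        (∀ k, ⟪p k, x⟫_ℂ = 0) → x = 0 := by
  set D := star (P₁ - P₂) * (P₁ - P₂) with hD
  have hDcomp : IsCompactOperator D := hP.isCompactOperator_star_mul_self
  have hDsym : D.IsSymmetric := (IsSelfAdjoint.star_mul_self _).isSymmetric
  have hDP : ∀ x, D (P₁ x) = P₁ (D x) := fun x =>
    DFunLike.congr_fun (commute_star_sub_mul_sub hP₁ hP₂).eq x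
  let V : {μ : ℂ // μ ≠ 1} → Submodule ℂ H := fun μ =>
    Module.End.eigenspace (D : Module.End ℂ H) μ ⊓ LinearMap.eqLocus (P₁ : H →ₗ[ℂ] H) LinearMap.id
  have hV : ∀ {μ x}, x ∈ V μ ↔ D x = (μ : ℂ) • x ∧ P₁ x = x := by
    intro μ x
    simp only [V, Submodule.mem_inf, Module.End.mem_eigenspace_iff]
    rfl
  have hVc : ∀ μ, CompleteSpace (V μ) := by
    intro μ
    have : IsClosed (V μ : Set H) := by
      have e : (V μ : Set H) = {x | D x = (μ : ℂ) • x} ∩ {x | P₁ x = x} := by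
        ext x
        exact hV
      rw [e]
      exact (isClosed_eq D.continuous (continuous_const_smul _)).inter
        (isClosed_eq P₁.continuous continuous_id)
    exact this.completeSpace_coe
  have hb := fun μ => exists_hilbertBasis ℂ (V μ)
  choose s b hbs using hb
  have hfam : OrthogonalFamily ℂ (fun μ => V μ) fun μ => (V μ).subtypeₗᵢ := by
    intro μ ν hμν x y
    have := hDsym.orthogonalFamily_eigenspaces (i := (μ : ℂ)) (j := (ν : ℂ))
      (fun h => hμν (Subtype.ext h))
    exact this ⟨x, x.2.1⟩ ⟨y, y.2.1⟩
  refine ⟨Σ μ, s μ, fun a => b a.1 a.2, fun a => 1 - (a.1 : ℂ),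
    hfam.orthonormal_sigma_orthonormal fun μ => (b μ).orthonormal,
    fun k => (hV.mp (b k.1 k.2).2).2, fun k => sub_ne_zero.mpr k.1.2.symm, fun k => ?_,
    fun x hx hE hpx => ?_⟩
  · have h1 := star_sub_mul_sub_apply hP₁ hP₂ (hV.mp (b k.1 k.2).2).2
    rw [← hD, (hV.mp (b k.1 k.2).2).1] at h1
    rw [sub_smul, one_smul, h1, sub_sub_cancel]
  · have hle : (⨆ μ, Module.End.eigenspace (D : Module.End ℂ H) μ) ≤ (ℂ ∙ x)ᗮ := by
      refine iSup_le fun μ y hy => ?_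
      rw [Submodule.mem_orthogonal_singleton_iff_inner_right, ← hx, hP₁.inner_apply_left]
      rw [Module.End.mem_eigenspace_iff] at hy
      have hy' : D (P₁ y) = μ • P₁ y := by
        rw [hDP, ← map_smul]
        exact congrArg P₁ hy
      by_cases hμ : μ = 1
      · rw [hμ, one_smul, hD, star_sub_mul_sub_apply hP₁ hP₂ (hP₁.apply_apply y),
          sub_eq_self] at hy'
        refine inner_eq_zero_symm.mp (hE _ (hP₁.apply_apply y) ?_)
        rw [← inner_self_eq_zero (𝕜 := ℂ), hP₂.inner_apply_left, hP₂.apply_apply,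
          hP₁.inner_apply_left, hy', inner_zero_right]
      · have hz : P₁ y ∈ V ⟨μ, hμ⟩ := hV.mpr ⟨hy', hP₁.apply_apply y⟩
        have h1 := (((b ⟨μ, hμ⟩).hasSum_repr ⟨P₁ y, hz⟩).mapL (V ⟨μ, hμ⟩).subtypeL).mapL
          (innerSL ℂ x)
        refine h1.unique ?_
        convert hasSum_zero using 2 with i
        have h2 := inner_eq_zero_symm.mp (hpx ⟨⟨μ, hμ⟩, i⟩)
        simp [h2]
    have hmem : x ∈ (⨆ μ, Module.End.eigenspace (D : Module.End ℂ H) μ)ᗮ := by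
      rw [Submodule.mem_orthogonal]
      intro y hy
      exact inner_eq_zero_symm.mp (Submodule.mem_orthogonal_singleton_iff_inner_right.mp (hle hy))
    rw [ContinuousLinearMap.orthogonalComplement_iSup_eigenspaces_eq_bot hDcomp hDsym] at hmem
    exact (Submodule.mem_bot ℂ).mp hmem

theorem norm_sub_le_of_principal (hP₁ : IsStarProjection P₁) (hP₂ : IsStarProjection P₂)
    {A B : H →L[ℂ] H} (hA : 0 ≤ A) (hAA : A * A = star (P₁ - P₂) * (P₁ - P₂))
    (hBs : B.IsSymmetric) (hBB : B * B = A) {p : H} {c : ℝ}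
    (hp : ‖p‖ = 1) (hc0 : 0 < c) (hc1 : c ≤ 1) (hP₁p : P₁ p = p)
    (hPP : P₁ (P₂ p) = (c : ℂ) ^ 2 • p) (hnorm : ‖P₂ p‖ = c) :
    ‖p - (c : ℂ)⁻¹ • P₂ p‖ ≤ Real.sqrt 2 * ‖B p‖ ^ 2 := by
  have habs : A (A p) = ((1 - c ^ 2 : ℝ) : ℂ) • p := by
    rw [← mul_apply_eq_comp, hAA, star_sub_mul_sub_apply hP₁ hP₂ hP₁p, hPP]
    push_cast
    rw [sub_smul, one_smul]
  have h1c : 0 ≤ 1 - c ^ 2 := by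
    have := pow_le_one₀ (n := 2) hc0.le hc1
    linarith
  have h1 := apply_eq_sqrt_smul_of_mul_self hA h1c habs
  have h2 : ‖B p‖ ^ 2 = Real.sqrt (1 - c ^ 2) := by
    have h3 : ⟪B p, B p⟫_ℂ = (Real.sqrt (1 - c ^ 2) : ℂ) := by
      have h4 : ⟪B p, B p⟫_ℂ = ⟪p, B (B p)⟫_ℂ := hBs p (B p)
      rw [h4, ← mul_apply_eq_comp, hBB, h1, inner_smul_right, inner_self_eq_norm_sq_to_K, hp]
      simp
    rw [inner_self_eq_norm_sq_to_K] at h3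
    simp only [Complex.coe_algebraMap] at h3
    exact_mod_cast h3
  have hq : ‖(c : ℂ)⁻¹ • P₂ p‖ = 1 := by
    rw [norm_smul, norm_inv, Complex.norm_real, hnorm, Real.norm_of_nonneg hc0.le]
    exact inv_mul_cancel₀ hc0.ne'
  have hpq : ⟪p, (c : ℂ)⁻¹ • P₂ p⟫_ℂ = c := by
    have h3 : ⟪p, P₂ p⟫_ℂ = ⟪p, P₁ (P₂ p)⟫_ℂ := by rw [← hP₁.inner_apply_left, hP₁p]
    rw [inner_smul_right, h3, hPP, inner_smul_right, inner_self_eq_norm_sq_to_K, hp]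
    have : (c : ℂ) ≠ 0 := by exact_mod_cast hc0.ne'
    simp
    field_simp
  rw [h2]
  refine le_of_sq_le_sq ?_ (by positivity)
  rw [mul_pow, Real.sq_sqrt h1c, Real.sq_sqrt (by norm_num), norm_sub_sq (𝕜 := ℂ), hp, hq, hpq]
  simp only [one_pow, RCLike.re_to_complex, Complex.ofReal_re]
  nlinarith [mul_nonneg hc0.le (sub_nonneg.mpr hc1)]

/-- The bases of principal vectors of a pair of projections with trace class difference. -/
theorem exists_principal_vectors (hP₁ : IsStarProjection P₁) (hP₂ : IsStarProjection P₂)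
    (hP : IsTraceClass (P₁ - P₂)) {n m : ℕ} {v : Fin n → H} {w : Fin m → H}
    (hv : Orthonormal ℂ v) (hw : Orthonormal ℂ w)
    (hv₁ : ∀ i, P₁ (v i) = v i) (hv₂ : ∀ i, P₂ (v i) = 0)
    (hw₁ : ∀ i, P₁ (w i) = 0) (hw₂ : ∀ i, P₂ (w i) = w i)
    (hvt : ∀ x, P₁ x = x → P₂ x = 0 → x ∈ Submodule.span ℂ (Set.range v))
    (hwt : ∀ x, P₁ x = 0 → P₂ x = x → x ∈ Submodule.span ℂ (Set.range w)) :
    ∃ (κ : Type u) (p q : κ → H), Orthonormal ℂ p ∧ Orthonormal ℂ q ∧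
      (∀ k l, k ≠ l → ⟪p k, q l⟫_ℂ = 0) ∧ (Summable fun k => ‖p k - q k‖) ∧
      (∀ x, HasSum (fun k => ⟪p k, x⟫_ℂ • p k) ((P₁ - ∑ i, rankOne ℂ (v i) (v i)) x)) ∧
      (∀ x, HasSum (fun k => ⟪q k, x⟫_ℂ • q k) ((P₂ - ∑ i, rankOne ℂ (w i) (w i)) x)) := by
  obtain ⟨κ, p, μ, hp, hpP, hμ, hPP, hptot⟩ := exists_principal_basis hP₁ hP₂ hP
  have hinner : ∀ k l, ⟪p k, P₂ (p l)⟫_ℂ = μ l * ⟪p k, p l⟫_ℂ := by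
    intro k l
    conv_lhs => rw [← hpP k, hP₁.inner_apply_left, hPP, inner_smul_right]
  have hc2 : ∀ k, (‖P₂ (p k)‖ : ℂ) ^ 2 = μ k := by
    intro k
    have h1 := hinner k k
    rw [inner_self_eq_norm_sq_to_K, hp.1, ← hP₂.apply_apply, ← hP₂.inner_apply_left,
      inner_self_eq_norm_sq_to_K] at h1
    simpa using h1
  have hc0 : ∀ k, (‖P₂ (p k)‖ : ℂ) ≠ 0 := by
    intro k h0
    have h1 := hc2 k
    rw [h0, zero_pow two_ne_zero] at h1
    exact hμ k h1.symm
  let q : κ → H := fun k => (‖P₂ (p k)‖ : ℂ)⁻¹ • P₂ (p k)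
  have hpq : ∀ k l, ⟪p k, q l⟫_ℂ = ‖P₂ (p l)‖ * ⟪p k, p l⟫_ℂ := by
    intro k l
    simp only [q]
    rw [inner_smul_right, hinner, ← hc2]
    field_simp [hc0 l]
  have hqq : ∀ k, P₂ (q k) = q k := fun k => by
    simp only [q]
    rw [map_smul, hP₂.apply_apply]
  have hq : Orthonormal ℂ q := by
    refine ⟨fun k => ?_, fun k l hkl => ?_⟩
    · simp only [q]
      rw [norm_smul, norm_inv, Complex.norm_real, norm_norm]
      exact inv_mul_cancel₀ (by exact_mod_cast hc0 k)
    · simp only [q]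
      rw [inner_smul_left, inner_smul_right, hP₂.inner_apply_left, hP₂.apply_apply, hinner,
        hp.2 hkl]
      simp
  refine ⟨κ, p, q, hp, hq, fun k l hkl => by rw [hpq, hp.2 hkl, mul_zero], ?_, ?_, ?_⟩
  · obtain ⟨B, hBs, hBB, -, hsum⟩ := hP.exists_sqrt
    refine Summable.of_nonneg_of_le (fun _ => norm_nonneg _) (fun k => ?_)
      ((hsum hp).mul_left (Real.sqrt 2))
    have hc1 : ‖P₂ (p k)‖ ≤ 1 := by
      have := (P₂.le_opNorm (p k)).trans
        (mul_le_mul_of_nonneg_right hP₂.norm_le (norm_nonneg _))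
      rwa [hp.1, mul_one] at this
    exact norm_sub_le_of_principal hP₁ hP₂ (CFC.abs_nonneg _) (CFC.abs_mul_abs _) hBs hBB (hp.1 k)
      ((norm_nonneg _).lt_of_ne fun h => hc0 k (by rw [← h]; simp)) hc1 (hpP k)
      (by rw [hc2, hPP]) rfl
  · refine (hP₁.sub_sum_rankOne hv hv₁ _).hasSum_inner_smul hp (fun k => ?_) fun x hx hpx => ?_
    · rw [sub_apply, (hpP k), sum_apply, Finset.sum_eq_zero, sub_zero]
      intro i _
      have h1 : μ k * ⟪v i, p k⟫_ℂ = 0 := by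
        rw [← inner_smul_right, ← hPP, ← hP₁.inner_apply_left, hv₁, ← hP₂.inner_apply_left, hv₂,
          inner_zero_left]
      rw [InnerProductSpace.rankOne_apply, (mul_eq_zero.mp h1).resolve_left (hμ k), zero_smul]
    · obtain ⟨hx₁, hxv⟩ := apply_eq_self_of_sub_sum_rankOne hP₁ hv hv₁ hx
      exact hptot x hx₁ (fun y hy hy' => inner_eq_zero_of_mem_span hxv (hvt y hy hy')) hpx
  · refine (hP₂.sub_sum_rankOne hw hw₂ _).hasSum_inner_smul hq (fun k => ?_) fun x hx hqx => ?_
    · rw [sub_apply, hqq, sum_apply, Finset.sum_eq_zero, sub_zero]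
      intro i _
      have : ⟪w i, q k⟫_ℂ = 0 := by
        simp only [q]
        rw [inner_smul_right, ← hP₂.inner_apply_left, hw₂, ← (hpP k), ← hP₁.inner_apply_left,
          hw₁, inner_zero_left, mul_zero]
      rw [InnerProductSpace.rankOne_apply, this, zero_smul]
    · obtain ⟨hx₂, hxw⟩ := apply_eq_self_of_sub_sum_rankOne hP₂ hw hw₂ hx
      have hpx : ∀ k, ⟪p k, x⟫_ℂ = 0 := fun k => by
        have h1 := hqx k
        simp only [q] at h1
        rw [inner_smul_left, hP₂.inner_apply_left, hx₂] at h1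
        refine (mul_eq_zero.mp h1).resolve_left ?_
        simpa using hc0 k
      have h0 : P₁ x = 0 := by
        refine hptot (P₁ x) (hP₁.apply_apply x) (fun y hy hy' => ?_) fun k => ?_
        · rw [← hP₁.inner_apply_left, hy, ← hx₂, ← hP₂.inner_apply_left, hy', inner_zero_left]
        · rw [← hP₁.inner_apply_left, (hpP k), hpx]
      have := inner_eq_zero_of_mem_span hxw (hwt x h0 hx₂)
      exact inner_self_eq_zero.mp this

end Principal

end

noncomputable section

open InnerProductSpace (rankOne)

/-! ### The Fredholm operator of a pair of projections -/

section Fredholm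

variable {H : Type u} [NormedAddCommGroup H] [InnerProductSpace ℂ H] [CompleteSpace H]

/-- A parametrix of `1 - D` for a compact self-adjoint operator `D`, which commutes with all
self-adjoint operators that commute with `D`. -/
theorem IsSelfAdjoint.exists_parametrix {D : H →L[ℂ] H} (hD : IsSelfAdjoint D)
    (hc : IsCompactOperator D) :
    ∃ R F : H →L[ℂ] H, R * (1 - D) = 1 - F ∧ (F : H →ₗ[ℂ] H).HasFiniteRange ∧
      ∀ C, IsSelfAdjoint C → Commute D C → Commute R C := by
  let N : Submodule ℂ H := Module.End.eigenspace (D : Module.End ℂ H) 1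
  have hN : ∀ {x}, x ∈ N ↔ D x = x := by
    intro x
    rw [Module.End.mem_eigenspace_iff, one_smul]
    rfl
  have : FiniteDimensional ℂ N :=
    ContinuousLinearMap.finite_dimensional_eigenspace hc 1 one_ne_zero
  let E : H →L[ℂ] H := N.starProjection
  have hE : IsSelfAdjoint E := isSelfAdjoint_starProjection N
  have hEN : ∀ x, E x ∈ N := fun x => N.starProjection_apply_mem x
  have hEeq : ∀ {x}, x ∈ N → E x = x := fun hx => Submodule.starProjection_eq_self_iff.mpr hx
  have hDE : D * E = E := by
    ext x
    exact hN.mp (hEN x)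
  have hED : E * D = E := by
    simpa [hD.star_eq, hE.star_eq] using congrArg star hDE
  have hEc : IsCompactOperator E := by
    rw [← hDE]
    exact hc.comp_clm E
  have hK : IsCompactOperator (D - E) := hc.sub hEc
  have hunit : IsUnit (1 - (D - E)) := by
    have h := (hK.hasEigenvalue_or_mem_resolventSet (μ := (1 : ℂ)) one_ne_zero).resolve_left ?_
    · simpa [spectrum.mem_resolventSet_iff] using h
    · intro h
      obtain ⟨x, hx⟩ := h.exists_hasEigenvector
      have h1 : D x - E x = x := by
        have := hx.apply_eq_smul
        rwa [one_smul] at this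
      have h2 : E x = 0 := by
        have := congrArg E h1
        rwa [map_sub, hEeq (hEN x), ← mul_apply_eq_comp, hED, sub_self, eq_comm] at this
      rw [h2, sub_zero] at h1
      exact hx.2 ((hEeq (hN.mpr h1)).symm.trans h2)
  obtain ⟨U, hU⟩ := hunit
  refine ⟨(U⁻¹ : (H →L[ℂ] H)ˣ), (U⁻¹ : (H →L[ℂ] H)ˣ) * E, ?_, ?_, ?_⟩
  · have h1 : 1 - D = U - E := by rw [hU]; abel
    rw [h1, mul_sub, Units.inv_mul]
  · have h1 : (E : H →ₗ[ℂ] H).HasFiniteRange := by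
      have : (E : H →ₗ[ℂ] H) = N.subtype ∘ₗ (N.orthogonalProjectionOnto : H →ₗ[ℂ] N) := rfl
      rw [this]
      exact LinearMap.HasFiniteRange.comp_left LinearMap.HasFiniteRange.of_isNoetherian_rng _
    exact h1.comp_left _
  · intro C hC hDC
    have hCN : E * C * E = C * E := by
      ext x
      refine hEeq (hN.mpr ?_)
      exact (DFunLike.congr_fun hDC.eq (E x)).trans (congrArg C (hN.mp (hEN x)))
    have hEC : Commute E C := by
      have h1 := congrArg star hCN
      simp only [star_mul, hE.star_eq, hC.star_eq] at h1
      rw [Commute, SemiconjBy, ← h1, ← mul_assoc, hCN]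
    refine Commute.units_inv_left ?_
    rw [hU]
    exact (Commute.one_left C).sub_left (hDC.sub_left hEC)

variable {P₁ P₂ : H →L[ℂ] H}

omit [CompleteSpace H] in
theorem pairOperator_apply_coe (x : P₁.range) : (pairOperator P₁ P₂ x : H) = P₂ (P₁ x) := rfl

theorem IsStarProjection.apply_coe {P : H →L[ℂ] H} (hP : IsStarProjection P) (x : P.range) :
    P (x : H) = x := by
  obtain ⟨_, y, rfl⟩ := x
  exact hP.apply_apply y

theorem isFredholm_pairOperator (hP₁ : IsStarProjection P₁) (hP₂ : IsStarProjection P₂)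
    (hP : IsTraceClass (P₁ - P₂)) : (pairOperator P₁ P₂).IsFredholm := by
  obtain ⟨R, F, hR, hF, hcomm⟩ := (IsSelfAdjoint.star_mul_self (P₁ - P₂)).exists_parametrix
    hP.isCompactOperator_star_mul_self
  have hD : star (P₂ - P₁) * (P₂ - P₁) = star (P₁ - P₂) * (P₁ - P₂) := by
    rw [← neg_sub P₁ P₂, star_neg, neg_mul_neg]
  have hR₁ : ∀ x, R (P₁ x) = P₁ (R x) := DFunLike.congr_fun
    (hcomm P₁ hP₁.isSelfAdjoint (commute_star_sub_mul_sub hP₁ hP₂)).eq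
  have hR₂ : ∀ x, R (P₂ x) = P₂ (R x) := DFunLike.congr_fun
    (hcomm P₂ hP₂.isSelfAdjoint (hD ▸ commute_star_sub_mul_sub hP₂ hP₁)).eq
  have hRF : ∀ x, R (x - (star (P₁ - P₂) * (P₁ - P₂)) x) = x - F x := DFunLike.congr_fun hR
  have hfin : ∀ {p : Submodule ℂ H} (g : p →ₗ[ℂ] p), (∀ x, (g x : H) = -F x) →
      g.HasFiniteRange := by
    intro p g hg
    have h1 : p.subtype ∘ₗ g = -((F : H →ₗ[ℂ] H) ∘ₗ p.subtype) := LinearMap.ext hg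
    have h2 : (p.subtype ∘ₗ g).HasFiniteRange := by
      rw [h1]
      exact (hF.comp_right _).neg
    rw [← LinearMap.ker_coFG_iff_hasFiniteRange] at h2 ⊢
    rwa [LinearMap.ker_comp_of_ker_eq_bot _ p.ker_subtype] at h2
  let V : P₂.range →L[ℂ] P₁.range :=
    ((P₁ ∘L R) ∘L P₂.range.subtypeL).codRestrict P₁.range fun x => ⟨R x, rfl⟩
  have hV : ∀ y, (V y : H) = P₁ (R y) := fun _ => rfl
  refine ContinuousLinearMap.IsFredholm.of_isQuasiInverse (v := V) ⟨?_, ?_⟩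
  · refine LinearMap.FiniteRangeSetoid.equiv_iff_hasFiniteRange.mpr (hfin _ fun x => ?_)
    show P₁ (R (P₂ (P₁ x))) - (x : H) = -F x
    have h1 := star_sub_mul_sub_apply hP₁ hP₂ (hP₁.apply_coe x)
    have h2 := hRF x
    rw [h1, sub_sub_cancel] at h2
    rw [hP₁.apply_coe, ← hR₁, h2]
    abel
  · refine LinearMap.FiniteRangeSetoid.equiv_iff_hasFiniteRange.mpr (hfin _ fun x => ?_)
    show P₂ (P₁ (P₁ (R x))) - (x : H) = -F x
    have h1 := star_sub_mul_sub_apply hP₂ hP₁ (hP₂.apply_coe x)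
    have h2 := hRF x
    rw [← hD, h1, sub_sub_cancel] at h2
    rw [hP₁.apply_apply, ← hR₁, ← hR₂, h2]
    abel

end Fredholm

/-! ### The index of a pair of quasi-free states -/

section Main

variable {H : Type u} [NormedAddCommGroup H] [InnerProductSpace ℂ H] [CompleteSpace H]
  {P₁ P₂ : H →L[ℂ] H} {ω₁ ω₂ : CAR H →L[ℂ] ℂ}

/-- An orthonormal basis of a finite-dimensional subspace, as a family in the ambient space. -/
theorem exists_orthonormal_span_eq {E : Type*} [NormedAddCommGroup E] [InnerProductSpace ℂ E]
    (K : Submodule ℂ E) [FiniteDimensional ℂ K] :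
    ∃ v : Fin (Module.finrank ℂ K) → E, Orthonormal ℂ v ∧ Submodule.span ℂ (Set.range v) = K := by
  let b := stdOrthonormalBasis ℂ K
  refine ⟨fun i => b i, b.orthonormal.comp_linearIsometry K.subtypeₗᵢ, ?_⟩
  have h := congrArg (Submodule.map K.subtype) b.toBasis.span_eq
  rw [Submodule.map_span, ← Set.range_comp, Submodule.map_top, Submodule.range_subtype] at h
  convert h using 3
  ext i
  simp

theorem exists_isIntertwiner_fredholmIndex (hP₁ : IsStarProjection P₁)
    (hP₂ : IsStarProjection P₂) (hP : IsTraceClass (P₁ - P₂)) (h₁ : IsQuasiFree P₁ ω₁)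
    (h₂ : IsQuasiFree P₂ ω₂) :
    ∃ u, IsIntertwiner u ω₁ ω₂ (fredholmIndex (pairOperator P₁ P₂)) := by
  have hT := isFredholm_pairOperator hP₁ hP₂ hP
  have := hT.finite_ker
  have hco : FiniteDimensional ℂ (P₂.range ⧸ (pairOperator P₁ P₂).range) := hT.finite_coker
  have := hP₂.completeSpace_range
  have : CompleteSpace (pairOperator P₁ P₂).range := hT.isClosed_range.completeSpace_coe
  let e := Submodule.quotientEquivOfIsCompl _ _
    (Submodule.isCompl_orthogonal (K := (pairOperator P₁ P₂).range))
  have : FiniteDimensional ℂ ((pairOperator P₁ P₂).range)ᗮ := Module.Finite.equiv e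
  obtain ⟨v', hv', hvs⟩ := exists_orthonormal_span_eq (pairOperator P₁ P₂).ker
  obtain ⟨w', hw', hws⟩ := exists_orthonormal_span_eq ((pairOperator P₁ P₂).range)ᗮ
  let v : _ → H := fun i => v' i
  let w : _ → H := fun i => w' i
  have hv : Orthonormal ℂ v := hv'.comp_linearIsometry P₁.range.subtypeₗᵢ
  have hw : Orthonormal ℂ w := hw'.comp_linearIsometry P₂.range.subtypeₗᵢ
  have hker : ∀ x : P₁.range, x ∈ (pairOperator P₁ P₂).ker ↔ P₂ x = 0 := by
    intro x
    rw [LinearMap.mem_ker, ← Subtype.coe_inj]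
    show P₂ (P₁ x) = 0 ↔ _
    rw [hP₁.apply_coe]
  have hcoker : ∀ y : P₂.range, y ∈ ((pairOperator P₁ P₂).range)ᗮ ↔ P₁ y = 0 := by
    intro y
    have hinner : ∀ x : P₁.range, ⟪pairOperator P₁ P₂ x, y⟫_ℂ = ⟪(x : H), P₁ y⟫_ℂ := by
      intro x
      rw [Submodule.coe_inner, pairOperator_apply_coe, hP₂.inner_apply_left, hP₂.apply_coe,
        hP₁.inner_apply_left]
    rw [Submodule.mem_orthogonal]
    constructor
    · intro h
      have h1 := h _ ⟨⟨P₁ y, y, rfl⟩, rfl⟩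
      exact inner_self_eq_zero.mp ((hinner _).symm.trans h1)
    · rintro h _ ⟨x, rfl⟩
      exact (hinner x).trans (by rw [h, inner_zero_right])
  have hspan : ∀ {P : H →L[ℂ] H} {n : ℕ} (z : Fin n → P.range) (x : P.range),
      x ∈ Submodule.span ℂ (Set.range z) →
        (x : H) ∈ Submodule.span ℂ (Set.range fun i => (z i : H)) := by
    intro P n z x hx
    have := Submodule.mem_map_of_mem (f := P.range.subtype) hx
    rwa [Submodule.map_span, ← Set.range_comp] at this
  have hv₁ : ∀ i, P₁ (v i) = v i := fun i => hP₁.apply_coe _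
  have hv₂ : ∀ i, P₂ (v i) = 0 := fun i =>
    (hker _).mp (hvs ▸ Submodule.subset_span (Set.mem_range_self i))
  have hw₂ : ∀ i, P₂ (w i) = w i := fun i => hP₂.apply_coe _
  have hw₁ : ∀ i, P₁ (w i) = 0 := fun i =>
    (hcoker _).mp (hws ▸ Submodule.subset_span (Set.mem_range_self i))
  obtain ⟨κ, p, q, hp, hq, hpq, hsum, hsp, hsq⟩ := exists_principal_vectors hP₁ hP₂ hP hv hw
    hv₁ hv₂ hw₁ hw₂
    (fun x hx₁ hx₂ => hspan v' ⟨x, x, hx₁⟩ (hvs.ge ((hker ⟨x, x, hx₁⟩).mpr hx₂)))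
    (fun x hx₁ hx₂ => hspan w' ⟨x, x, hx₂⟩ (hws.ge ((hcoker ⟨x, x, hx₂⟩).mpr hx₁)))
  obtain ⟨hQ₁, u₁, ω₁', h₁', hu₁⟩ := h₁.exists_isIntertwiner_sub_sum hv hP₁ hv₁ Finset.univ
  obtain ⟨hQ₂, u₂, ω₂', h₂', hu₂⟩ := h₂.exists_isIntertwiner_sub_sum hw hP₂ hw₂ Finset.univ
  obtain ⟨u, hu⟩ := exists_isIntertwiner_of_orthonormal hp hq hpq hsum hQ₁ hQ₂ hsp hsq h₁' h₂'
  have h := ((hu₁.trans hP₁ hQ₁ h₁ h₁' hu).trans hP₁ hQ₂ h₁ h₂' (hu₂.symm hP₂ h₂))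
  refine ⟨star u₂ * (u * u₁), ?_⟩
  convert h using 1
  rw [fredholmIndex, e.finrank_eq]
  simp [sub_eq_add_neg]

theorem AutFlow.hasGenerator_generator {A : Type*} [CStarAlgebra A] {ρ : AutFlow A} {x : A}
    (hx : x ∈ ρ.domain) : ρ.HasGenerator x (ρ.generator x) := by
  rw [AutFlow.generator, dif_pos hx]
  exact hx.choose_spec

theorem IsIntertwiner.I_mul_apply_generator {k : ℤ} {u : CAR H} (hP₁ : IsStarProjection P₁)
    (hP₂ : IsStarProjection P₂) (h₁ : IsQuasiFree P₁ ω₁) (h₂ : IsQuasiFree P₂ ω₂)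
    (hu : IsIntertwiner u ω₁ ω₂ k) {u' : CAR H}
    (hu' : u' ∈ (CAR.charge H).intertwiners ω₁ ω₂) :
    Complex.I * ω₁ (star u' * (CAR.charge H).generator u') = k := by
  obtain ⟨hU, hdom, happ⟩ := hu'
  have hgen := AutFlow.hasGenerator_generator hdom
  have ht₁ := ((ω₁.continuous.comp (continuous_const_mul (star u'))).tendsto _).comp hgen
  have hder : HasDerivAt (fun t : ℝ => Complex.exp (-(Complex.I * k * t))) (-(Complex.I * k)) 0 := by
    have := ((Complex.ofRealCLM.hasDerivAt (x := (0 : ℝ))).const_mul (Complex.I * k)).neg.cexp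
    simpa using this
  have ht₂ := (hasDerivAt_iff_tendsto_slope_zero.mp hder).mono_left
    (nhdsWithin_mono (0 : ℝ) fun t ht => (Set.mem_Ioi.mp ht).ne')
  have heq : (fun t : ℝ => t⁻¹ • (Complex.exp (-(Complex.I * k * ((0 + t : ℝ) : ℂ))) -
      Complex.exp (-(Complex.I * k * ((0 : ℝ) : ℂ))))) = (ω₁ ∘ (star u' * ·)) ∘
      fun t : ℝ => t⁻¹ • ((CAR.charge H).aut t u' - u') := by
    funext t
    have h1 := apply_star_mul_aut_eq hP₁ hP₂ h₁ h₂ hu.mem_unitary hu.apply_eq happ t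
    rw [hu.charge_eq] at h1
    simp only [Function.comp_apply, mul_smul_comm, mul_sub, map_sub,
      ω₁.map_smul_of_tower, h1, Unitary.star_mul_self_of_mem hU, h₁.apply_one, zero_add]
    simp
  have hlim := tendsto_nhds_unique (heq ▸ ht₂) ht₁
  have hval : ω₁ (star u' * (CAR.charge H).generator u') = -(Complex.I * k) := hlim.symm
  rw [hval, mul_neg, ← mul_assoc, Complex.I_mul_I, neg_one_mul, neg_neg]

end Main

theorem mainTheorem3 {H : Type u} [NormedAddCommGroup H] [InnerProductSpace ℂ H] [CompleteSpace H]
    (P₁ P₂ : H →L[ℂ] H) (hP₁ : IsStarProjection P₁) (hP₂ : IsStarProjection P₂)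
    (hP : IsTraceClass (P₁ - P₂)) :
    (∃! ω : CAR H →L[ℂ] ℂ, IsQuasiFree P₁ ω) ∧
    (∃! ω : CAR H →L[ℂ] ℂ, IsQuasiFree P₂ ω) ∧
    (pairOperator P₁ P₂).IsFredholm ∧
    ∀ ω₁ ω₂ : CAR H →L[ℂ] ℂ, IsQuasiFree P₁ ω₁ → IsQuasiFree P₂ ω₂ →
      (CAR.charge H).LocallyComparable ω₁ ω₂ ∧
      (CAR.charge H).Invariant ω₁ ∧ (CAR.charge H).Invariant ω₂ ∧
      (∀ u ∈ (CAR.charge H).intertwiners ω₁ ω₂,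
        Complex.I * ω₁ (star u * (CAR.charge H).generator u) =
          (CAR.charge H).index ω₁ ω₂) ∧
      (CAR.charge H).index ω₁ ω₂ = (fredholmIndex (pairOperator P₁ P₂) : ℂ) := by
  refine ⟨existsUnique_isQuasiFree hP₁, existsUnique_isQuasiFree hP₂,
    isFredholm_pairOperator hP₁ hP₂ hP, fun ω₁ ω₂ h₁ h₂ => ?_⟩
  obtain ⟨u, hu⟩ := exists_isIntertwiner_fredholmIndex hP₁ hP₂ hP h₁ h₂
  obtain ⟨d, hd⟩ := hu.exists_deriv
  have hne : ((CAR.charge H).intertwiners ω₁ ω₂).Nonempty :=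
    ⟨u, hu.mem_unitary, hd.mem_domain, hu.apply_eq⟩
  have hindex : (CAR.charge H).index ω₁ ω₂ = (fredholmIndex (pairOperator P₁ P₂) : ℂ) := by
    rw [AutFlow.index, dif_pos hne]
    exact hu.I_mul_apply_generator hP₁ hP₂ h₁ h₂ hne.some_mem
  refine ⟨⟨h₁.mem_pureStates hP₁, h₂.mem_pureStates hP₂, hne⟩, h₁.invariant hP₁,
    h₂.invariant hP₂, fun u' hu' => ?_, hindex⟩
  rw [hindex, hu.I_mul_apply_generator hP₁ hP₂ h₁ h₂ hu']

end
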